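/- **Setting.** Fix $N\in\mathbb N$ and $r>0$; put $C_r=\overline{B_r}\times\overline{B_r}\subset\mathbb R^N\times\mathbb R^N$. For $A,B\subseteq\mathbb R^N$ let $\operatorname{dist}(A,B)=\inf\{|x-y|:x\in A,\,y\in B\}\in[0,+\infty]$, which is $+\infty$ if $A$ or $B$ is empty. For $E\subseteq\mathbb R^N\times[0,\infty)$ put $E(t)=\{x:(x,t)\in E\}$; let $(A)_\delta=\bigcup_{x\in A}B_\delta(x)$, so that $(\emptyset)_\delta=\emptyset$. For $T\in[0,+\infty]$, let $L^\infty_{\mathbf w}(\mathbb R^N\times(0,T);\mathcal M^+(C_r))$ be the set of maps $z$ from $\mathbb R^N\times(0,T)$ to the nonnegative Radon measures on $C_r$ such that $(w,t)\mapsto\int_{C_r} f\,dz_{(w,t)}$ is Lebesgue measurable for every $f\in C^0(C_r)$ and $(w,t)\mapsto z_{(w,t)}(C_r)$ is essentially bounded. The nonlocal divergence of such a $z$ is the signed Radon measure $\mathfrak{Div}^r z$ on $\mathbb R^N\times(0,T)$ with $$\int\varphi\,d(\mathfrak{Div}^rz)=-\frac1{2r}\int_0^T\!\int_{\mathbb R^N}\!\int_{C_r}\big(\varphi(w+x,t)-\varphi(w+y,t)\big)\,dz_{(w,t)}(x,y)\,dw\,dt\qquad\text{for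 all }\varphi\in C^0_c(\mathbb R^N\times(0,T)).$$ **Weak superflows.** Let $E^0\subseteq\mathbb R^N$ be closed with compact boundary. A closed set $E\subseteq\mathbb R^N\times[0,\infty)$ is a *weak superflow* of the Minkowski flow $V=-\mathcal K_r$ with initial datum $E^0$ if (a) $E(0)\subseteq E^0$, and either $E(t)$ is bounded for all $t\ge0$ or $\mathbb R^N\setminus E(t)$ is bounded for all $t\ge0$; (b) for all $t\ge0$ and $\delta>0$ there is $\tau>0$ such that $E(s)\subseteq(E(t))_\delta$ for all $s\in(t,t+\tau)$; (c) for all $t>0$, $E(s)\to E(t)$ in the sense of Kuratowski as $s\nearrow t$; that is, for all $s_n\in[0,t)$ with $s_n\to t$, every cluster point of every sequence $x_n\in E(s_n)$ lies in $E(t)$, and every $x\in E(t)$ is the limit of a sequence $x_n\in E(s_n)$; (d) with $T^{\rm ext}=\inf\{t>0: E(s)=\emptyset\ \forall s\ge t\}\in[0,+\infty]$ and $d(x,t)=\operatorname{dist}(x,E(t))$, there is $z\in L^\infty_{\mathbf w}(\mathbb R^N\times(0,T^{\rm ext});\mathcal M^+(C_r))$ such that - (d1) $d$ is locally integrable in the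 open set $(\mathbb R^N\times(0,T^{\rm ext}))\setminus E$ and $\partial_td\ge\mathfrak{Div}^rz$ there in the sense of distributions (tested with nonnegative $C^\infty_c$ functions), equivalently as measures; - (d2) for a.e. $(w,t)\in\mathbb R^N\times(0,T^{\rm ext})$ one has $z_{(w,t)}(C_r)\le1$ and $\int_{C_r}(d(w+x,t)-d(w+y,t))\,dz_{(w,t)}(x,y)=\operatorname*{osc}_{B_r(w)}d(\cdot,t)$, where $\operatorname{osc}$ is the essential supremum minus the essential infimum; - (d3) for every $\lambda>0$, the positive part $(\mathfrak{Div}^rz)^+$, restricted to $\{(w,t)\in\mathbb R^N\times(0,T^{\rm ext}): d(w,t)\ge\lambda\}$, is absolutely continuous with respect to Lebesgue measure with density in $L^\infty$. **Weak subflows.** A relatively open set $A\subseteq\mathbb R^N\times[0,\infty)$ is a *weak subflow* with initial datum $E^0$ if $(\mathbb R^N\times[0,\infty))\setminus A$ is a weak superflow with initial datum $\mathbb R^N\setminus\operatorname{Int}(E^0)$. **Theorem.** Let $E^0,F^0\subseteq\mathbb R^N$ be closed sets with compact boundary, let $E$ be a weak superflow with initial datum $E^0$ and $F$ a weak subflow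 with initial datum $F^0$. If $\Delta:=\operatorname{dist}(E^0,\mathbb R^N\setminus F^0)>0$, then $$\operatorname{dist}(E(t),\mathbb R^N\setminus F(t))\ \ge\ \Delta\qquad\text{for all }t\ge0.$$ -/

import Mathlib

open MeasureTheory Set Filter
open scoped Topology NNReal ContDiff

namespace MinkowskiFlow

/-- The Euclidean space `ℝ^N`. -/
abbrev Space (N : ℕ) : Type := EuclideanSpace ℝ (Fin N)

/-- The distance `inf {|x - y| : x ∈ A, y ∈ B}` of two sets, equal to `+∞` if one of them is
empty. -/
noncomputable def setDist {N : ℕ} (A B : Set (Space N)) : ENNReal :=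
  ⨅ x ∈ A, ⨅ y ∈ B, edist x y

/-- The closed half space-time `ℝ^N × [0, ∞)`, as a subset of `ℝ^N × ℝ`. -/
def halfSpace (N : ℕ) : Set (Space N × ℝ) := {p | 0 ≤ p.2}

/-- The time slice `E(t) = {x : (x, t) ∈ E}`. -/
def slice {N : ℕ} (E : Set (Space N × ℝ)) (t : ℝ) : Set (Space N) := {x | (x, t) ∈ E}

/-- Kuratowski convergence of a sequence of sets `D n` to the set `D'`. -/
def KuratowskiTendsto {N : ℕ} (D : ℕ → Set (Space N)) (D' : Set (Space N)) : Prop :=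
  (∀ u : ℕ → Space N, (∀ n, u n ∈ D n) → ∀ x, MapClusterPt x atTop u → x ∈ D') ∧
  (∀ x ∈ D', ∃ u : ℕ → Space N, (∀ n, u n ∈ D n) ∧ Tendsto u atTop (𝓝 x))

/-- The extinction time `inf {t > 0 : E(s) = ∅ for all s ≥ t}`, equal to `+∞` if there is no such
`t`. -/
noncomputable def extinctionTime {N : ℕ} (E : Set (Space N × ℝ)) : EReal :=
  ⨅ t ∈ {t : ℝ | 0 < t ∧ ∀ s, t ≤ s → slice E s = ∅}, (t : EReal)

/-- The open space-time cylinder `ℝ^N × (0, T)`, where `T` may be `+∞`. -/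
def spaceTimeCylinder (N : ℕ) (T : EReal) : Set (Space N × ℝ) := {p | 0 < p.2 ∧ (p.2 : EReal) < T}

/-- The function `d(x, t) = dist(x, E(t))`. -/
noncomputable def distTo {N : ℕ} (E : Set (Space N × ℝ)) (p : Space N × ℝ) : ℝ :=
  Metric.infDist p.1 (slice E p.2)

/-- The essential oscillation `ess sup_A v - ess inf_A v`. It is only used for functions that are
bounded on a set `A` of positive measure. -/
noncomputable def essOsc {N : ℕ} (A : Set (Space N)) (v : Space N → ℝ) : ℝ :=
  essSup v (volume.restrict A) - essInf v (volume.restrict A)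

/-- The compact set `C_r = closedBall 0 r × closedBall 0 r`. -/
def Cr (N : ℕ) (r : ℝ) : Set (Space N × Space N) :=
  Metric.closedBall 0 r ×ˢ Metric.closedBall 0 r

/-- The weak-star measurable, essentially bounded maps from `ℝ^N × (0, T)` to the nonnegative
Radon measures on `C_r`. A Radon measure on the compact set `C_r` is a finite Borel measure
on `ℝ^N × ℝ^N` that vanishes outside `C_r`; the values of `z` outside the cylinder do not matter. -/
structure IsMeasureField {N : ℕ} (r : ℝ) (T : EReal)
    (z : Space N × ℝ → Measure (Space N × Space N)) : Prop where
  finite : ∀ p ∈ spaceTimeCylinder N T, IsFiniteMeasure (z p)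
  concentrated : ∀ p ∈ spaceTimeCylinder N T, z p (Cr N r)ᶜ = 0
  measurable : ∀ f : Space N × Space N → ℝ, Continuous f →
    AEMeasurable (fun p => ∫ q, f q ∂(z p)) (volume.restrict (spaceTimeCylinder N T))
  bounded : ∃ M : ℝ≥0, ∀ᵐ p ∂(volume.restrict (spaceTimeCylinder N T)), z p (Cr N r) ≤ M

/-- `μpos` and `μneg` are the positive and the negative part of the nonlocal divergence
`Div^r z`, which is the signed Radon measure on `ℝ^N × (0, T)` such that
`∫ φ d(Div^r z) = -1/(2r) ∫∫∫ (φ(w + x, t) - φ(w + y, t)) dz_{(w,t)}(x, y) dw dt`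
for all continuous `φ` with compact support in `ℝ^N × (0, T)`. -/
structure IsNonlocalDivergence {N : ℕ} (r : ℝ) (T : EReal)
    (z : Space N × ℝ → Measure (Space N × Space N)) (μpos μneg : Measure (Space N × ℝ)) :
    Prop where
  pos_radon : ∀ K, IsCompact K → K ⊆ spaceTimeCylinder N T → μpos K < ⊤
  neg_radon : ∀ K, IsCompact K → K ⊆ spaceTimeCylinder N T → μneg K < ⊤
  pos_compl : μpos (spaceTimeCylinder N T)ᶜ = 0
  neg_compl : μneg (spaceTimeCylinder N T)ᶜ = 0
  singular : μpos.MutuallySingular μneg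
  pairing : ∀ φ : Space N × ℝ → ℝ, Continuous φ → HasCompactSupport φ →
    tsupport φ ⊆ spaceTimeCylinder N T →
    (∫ p, φ p ∂μpos) - (∫ p, φ p ∂μneg) =
      -(1 / (2 * r)) * ∫ p in spaceTimeCylinder N T,
        (∫ q, (φ (p.1 + q.1, p.2) - φ (p.1 + q.2, p.2)) ∂(z p))

/-- The existence of a generalised Cahn-Hoffman field `z` for the distance function `d` of `E`
such that `∂_t d ≥ Div^r z` outside `E`, up to the extinction time of `E`. -/
def HasCahnHoffmanField {N : ℕ} (r : ℝ) (E : Set (Space N × ℝ)) : Prop :=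
  ∃ (z : Space N × ℝ → Measure (Space N × Space N)) (μpos μneg : Measure (Space N × ℝ)),
    IsMeasureField r (extinctionTime E) z ∧
    IsNonlocalDivergence r (extinctionTime E) z μpos μneg ∧
    -- `∂_t d ≥ Div^r z` in `(ℝ^N × (0, T)) \ E`, where `∂_t d` is the distributional derivative
    LocallyIntegrableOn (distTo E) (spaceTimeCylinder N (extinctionTime E) \ E) volume ∧
    (∀ φ : Space N × ℝ → ℝ, ContDiff ℝ ∞ φ → HasCompactSupport φ →
      tsupport φ ⊆ spaceTimeCylinder N (extinctionTime E) \ E → (∀ p, 0 ≤ φ p) →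
      (∫ p, φ p ∂μpos) - (∫ p, φ p ∂μneg) ≤
        -∫ p, distTo E p * deriv (fun s => φ (p.1, s)) p.2) ∧
    -- `z` has mass at most one and attains the oscillation of `d`
    (∀ᵐ p ∂(volume.restrict (spaceTimeCylinder N (extinctionTime E))),
      z p (Cr N r) ≤ 1 ∧
      ∫ q, (distTo E (p.1 + q.1, p.2) - distTo E (p.1 + q.2, p.2)) ∂(z p) =
        essOsc (Metric.ball p.1 r) (fun x => distTo E (x, p.2))) ∧
    -- on `{d ≥ l}` the measure `(Div^r z)^+` has a bounded density
    (∀ l : ℝ, 0 < l → ∃ M : ℝ≥0,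
      μpos.restrict {p | p ∈ spaceTimeCylinder N (extinctionTime E) ∧ l ≤ distTo E p} ≤ M • volume)

/-- `E` is a weak superflow, with initial datum `E0`, of the Minkowski flow of scale `r`. -/
structure IsWeakSuperflow {N : ℕ} (r : ℝ) (E0 : Set (Space N)) (E : Set (Space N × ℝ)) :
    Prop where
  subset_halfSpace : E ⊆ halfSpace N
  closed : IsClosed E
  initial : slice E 0 ⊆ E0
  bounded : (∀ t, 0 ≤ t → Bornology.IsBounded (slice E t)) ∨
    (∀ t, 0 ≤ t → Bornology.IsBounded (slice E t)ᶜ)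
  right : ∀ t, 0 ≤ t → ∀ δ, 0 < δ → ∃ τ, 0 < τ ∧
    ∀ s ∈ Ioo t (t + τ), slice E s ⊆ Metric.thickening δ (slice E t)
  left : ∀ t, 0 < t → ∀ s : ℕ → ℝ, (∀ n, 0 ≤ s n ∧ s n < t) → Tendsto s atTop (𝓝 t) →
    KuratowskiTendsto (fun n => slice E (s n)) (slice E t)
  field : HasCahnHoffmanField r E

/-- `A` is a weak subflow, with initial datum `E0`, of the Minkowski flow of scale `r`: it is
relatively open in `ℝ^N × [0, ∞)`, and its complement in `ℝ^N × [0, ∞)` is a weak superflow with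
initial datum the complement of the interior of `E0`. -/
structure IsWeakSubflow {N : ℕ} (r : ℝ) (E0 : Set (Space N)) (A : Set (Space N × ℝ)) :
    Prop where
  relOpen : ∃ O : Set (Space N × ℝ), IsOpen O ∧ A = O ∩ halfSpace N
  compl : IsWeakSuperflow r (interior E0)ᶜ (halfSpace N \ A)

end MinkowskiFlow

open scoped Convolution Interval

namespace MinkowskiFlow

/-! The complement `G` of the subflow is itself a superflow, so the claim is symmetric: two
superflows `E`, `G` at mutual distance at least `Δ` stay so. Let `d₁`, `d₂` be the distances to
their slices. Formally `∂_t d_i ≥ Div z_i` away from the sets, so for a function `f = γ(d₁, d₂) ≥ 0`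
nonincreasing in both arguments the derivative of the energy `∫ (Δ - d₁ - d₂)₊² / 2`, with `f = (Δ -
d₁ - d₂)₊`, is at most `-∫ f d(Div z₁ + Div z₂)`.

This is nonpositive by a monotonicity property of the oscillation
(`AttainsOsc.integral_add_nonpos`). The measure `z₁` charges only pairs at which `d₁` attains its
maximum and its minimum on the ball, and likewise for `z₂` and `d₂`; bounding the other distance by
its extreme values gives two estimates that cancel when both masses are one. A mass below one occurs
only for a distance that is constant on the ball, and then the remaining sign is favourable.

The inequalities fail on the sets themselves. Hence each `d_i` is truncated from below at a level `η
+ C (t - a)` rising with speed `C`, where `C` bounds the density of `(Div z_i)⁺` away from the sets: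
below the level the truncated function grows at rate `C ≥ (Div z_i)⁺`, so it still satisfies the
inequality. The test function then vanishes near the sets, and its support is compact as soon as one
of the slices is bounded.

The distances may jump in time, so the chain rule is replaced by backward differences, convexity,
and forward averages of the test function (`forwardIntegral_pairing_le`,
`IsLocalSupersolution.pairing_forwardIntegral_le`, `pairing_le_energy_sub`). Letting the step tend
to zero gives `energy_antitone`. Condition (b) makes the energy arbitrarily small just after the
starting time, hence zero; evaluating it at the midpoint of two points that are too close gives a
contradiction (`separated_right_of_isBounded`). Left limits (c) and an induction along the time axis
(`forall_ge_of_propagation`) extend the separation to all times. -/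

instance isAddHaarMeasure_volume_spaceTime (N : ℕ) :
    (volume : Measure (Space N × ℝ)).IsAddHaarMeasure :=
  inferInstanceAs ((volume : Measure (Space N)).prod (volume : Measure ℝ)).IsAddHaarMeasure

/-! ### Forward time averages. -/

/-- The integral of `F` over the forward time interval of length `ε`. -/
noncomputable def forwardIntegral {N : ℕ} (ε : ℝ) (F : Space N × ℝ → ℝ) (p : Space N × ℝ) : ℝ :=
  ∫ σ in (0 : ℝ)..ε, F (p + (0, σ))

section ForwardIntegral

variable {N : ℕ} {ε B : ℝ} {F : Space N × ℝ → ℝ}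

theorem forwardIntegral_eq_interval (p : Space N × ℝ) :
    forwardIntegral ε F p = ∫ t in p.2..(p.2 + ε), F (p.1, t) := by
  have h := intervalIntegral.integral_comp_add_left (a := 0) (b := ε) (fun t => F (p.1, t)) p.2
  simp only [add_zero] at h
  rw [← h]
  simp [forwardIntegral, Prod.add_def]

theorem forwardIntegral_eq_indicator (hε : 0 ≤ ε) (p : Space N × ℝ) :
    forwardIntegral ε F p = ∫ t, (Ioc p.2 (p.2 + ε)).indicator (fun t => F (p.1, t)) t := by
  rw [forwardIntegral_eq_interval, intervalIntegral.integral_of_le (by linarith),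
    integral_indicator measurableSet_Ioc]

theorem integrable_of_bdd_support {α : Type*} [MeasurableSpace α] {μ : Measure α} {f : α → ℝ}
    {s : Set α} (hf : AEStronglyMeasurable f μ) (hs : μ s < ⊤)
    (hB : ∀ x, |f x| ≤ B) (h0 : ∀ x, f x ≠ 0 → x ∈ s) : Integrable f μ := by
  have h1 : IntegrableOn f s μ :=
    IntegrableOn.of_bound hs hf.restrict B (Eventually.of_forall hB)
  refine (integrableOn_iff_integrable_of_support_subset ?_).1 h1
  intro x hx
  exact h0 x hx

/-- Averaging in time repairs jumps in time: for almost every integration time, the indicator of the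
moving window is locally constant in its endpoints. The average of a test function that is only
continuous in space is therefore admissible in the pairing. -/
theorem continuous_forwardIntegral (hε : 0 ≤ ε) (hF : Measurable F) (hB : ∀ p, |F p| ≤ B)
    (hc : ∀ t, Continuous fun x => F (x, t)) : Continuous (forwardIntegral ε F) := by
  have hB0 : 0 ≤ B := (abs_nonneg _).trans (hB 0)
  rw [continuous_iff_continuousAt]
  rintro ⟨x₀, s₀⟩
  have heq : forwardIntegral ε F = fun p : Space N × ℝ =>
      ∫ t, (Ioc p.2 (p.2 + ε)).indicator (fun t => F (p.1, t)) t :=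
    funext fun p => forwardIntegral_eq_indicator hε p
  rw [heq]
  refine continuousAt_of_dominated
    (bound := (Icc (s₀ - 1) (s₀ + 1 + ε)).indicator fun _ => B) ?_ ?_ ?_ ?_
  · refine Eventually.of_forall fun p => ?_
    exact ((hF.comp measurable_prodMk_left).indicator measurableSet_Ioc).aestronglyMeasurable
  · have hn : ∀ᶠ p : Space N × ℝ in 𝓝 (x₀, s₀), p.2 ∈ Ioo (s₀ - 1) (s₀ + 1) :=
      continuous_snd.continuousAt (Ioo_mem_nhds (by simp) (by simp))
    filter_upwards [hn] with p hp
    refine Eventually.of_forall fun t => ?_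
    by_cases ht : t ∈ Ioc p.2 (p.2 + ε)
    · have ht' : t ∈ Icc (s₀ - 1) (s₀ + 1 + ε) :=
        ⟨by linarith [hp.1, ht.1], by linarith [hp.2, ht.2]⟩
      rw [indicator_of_mem ht, indicator_of_mem ht']
      exact hB _
    · rw [indicator_of_notMem ht, norm_zero]
      exact indicator_nonneg (fun _ _ => hB0) _
  · exact (integrable_indicator_iff measurableSet_Icc).2
      (integrableOn_const (by simp) )
  · have h1 : ∀ᵐ t : ℝ, t ≠ s₀ := by simp [ae_iff]
    have h2 : ∀ᵐ t : ℝ, t ≠ s₀ + ε := by simp [ae_iff]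
    filter_upwards [h1, h2] with t ht1 ht2
    have hcs : ContinuousAt (fun p : Space N × ℝ => p.2) (x₀, s₀) := continuous_snd.continuousAt
    by_cases ht : t ∈ Ioc s₀ (s₀ + ε)
    · have hev : ∀ᶠ p : Space N × ℝ in 𝓝 (x₀, s₀), t ∈ Ioc p.2 (p.2 + ε) := by
        have hlt : s₀ < t := ht.1
        have hlt2 : t - ε < s₀ := by
          have := lt_of_le_of_ne ht.2 ht2
          linarith
        filter_upwards [hcs (Ioo_mem_nhds hlt2 hlt)] with p hp
        exact ⟨hp.2, by linarith [hp.1]⟩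
      refine ContinuousAt.congr (f := fun p : Space N × ℝ => F (p.1, t)) ?_ ?_
      · exact ((hc t).comp continuous_fst).continuousAt
      · filter_upwards [hev] with p hp
        rw [indicator_of_mem hp]
    · have hev : ∀ᶠ p : Space N × ℝ in 𝓝 (x₀, s₀), t ∉ Ioc p.2 (p.2 + ε) := by
        rcases lt_or_gt_of_ne ht1 with h | h
        · filter_upwards [hcs (Ioi_mem_nhds h)] with p hp hmem
          exact absurd hmem.1 (not_lt.2 (le_of_lt hp))
        · have h3 : s₀ + ε < t := by
            by_contra hcon
            exact ht ⟨h, not_lt.1 hcon⟩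
          have h4 : s₀ < t - ε := by linarith
          filter_upwards [hcs (Iio_mem_nhds h4)] with p hp hmem
          have h5 : p.2 < t - ε := hp
          linarith [hmem.2]
      refine ContinuousAt.congr (f := fun _ : Space N × ℝ => (0 : ℝ)) continuousAt_const ?_
      filter_upwards [hev] with p hp
      rw [indicator_of_notMem hp]

theorem abs_forwardIntegral_le (hε : 0 ≤ ε) (hB : ∀ p, |F p| ≤ B) (p : Space N × ℝ) :
    |forwardIntegral ε F p| ≤ B * ε := by
  have h := intervalIntegral.norm_integral_le_of_norm_le_const (a := 0) (b := ε) (C := B)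
    (f := fun σ => F (p + (0, σ))) (fun x _ => hB _)
  simpa [abs_of_nonneg hε, forwardIntegral] using h

theorem forwardIntegral_nonneg (hε : 0 ≤ ε) (h0 : ∀ p, 0 ≤ F p) (p : Space N × ℝ) :
    0 ≤ forwardIntegral ε F p :=
  intervalIntegral.integral_nonneg hε fun _ _ => h0 _

theorem exists_of_forwardIntegral_ne_zero (hε : 0 ≤ ε) {p : Space N × ℝ}
    (h : forwardIntegral ε F p ≠ 0) : ∃ σ ∈ Icc 0 ε, F (p + (0, σ)) ≠ 0 := by
  by_contra hcon
  push Not at hcon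
  refine h ?_
  rw [forwardIntegral, intervalIntegral.integral_congr (g := fun _ => 0)]
  · simp
  · intro σ hσ
    rw [uIcc_of_le hε] at hσ
    exact hcon σ hσ

theorem measurable_shift (hF : Measurable F) :
    Measurable fun q : ℝ × (Space N × ℝ) => F (q.2 + (0, q.1)) := by
  refine hF.comp ?_
  fun_prop

theorem integrable_shift (hi : Integrable F) (σ : ℝ) :
    Integrable fun p : Space N × ℝ => F (p + (0, σ)) := hi.comp_add_right _

theorem integrable_shift_prod (hF : Measurable F) (hi : Integrable F) :
    Integrable (fun q : ℝ × (Space N × ℝ) => F (q.2 + (0, q.1)))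
      ((volume.restrict (Ι 0 ε)).prod volume) := by
  rw [integrable_prod_iff (measurable_shift hF).aestronglyMeasurable]
  refine ⟨Eventually.of_forall fun σ => integrable_shift hi σ, ?_⟩
  have : ∀ σ : ℝ, ∫ p : Space N × ℝ, ‖F (p + (0, σ))‖ = ∫ p, ‖F p‖ := fun σ =>
    integral_add_right_eq_self (fun p => ‖F p‖) ((0 : Space N), σ)
  simp only [this]
  exact integrableOn_const (by simp [uIoc])

theorem integral_forwardIntegral (hF : Measurable F) (hi : Integrable F) :
    ∫ p, forwardIntegral ε F p = ε * ∫ p, F p := by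
  have h := intervalIntegral_integral_swap (μ := volume) (a := 0) (b := ε)
    (f := fun σ (p : Space N × ℝ) => F (p + (0, σ))) (integrable_shift_prod hF hi)
  simp only [forwardIntegral]
  rw [← h]
  have : ∀ σ : ℝ, ∫ p : Space N × ℝ, F (p + (0, σ)) = ∫ p, F p := fun σ =>
    integral_add_right_eq_self F ((0 : Space N), σ)
  simp [this]

end ForwardIntegral

/-! ### Averaged test functions in the weak inequality. -/

section Mollification

variable {N : ℕ} {ε B : ℝ} {F : Space N × ℝ → ℝ}

/-- By Fubini, mollification commutes with averaging, so the time derivative of a mollified average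
is a forward difference of the mollified function. -/
theorem convolution_forwardIntegral {ρ : Space N × ℝ → ℝ} (hρ : Continuous ρ)
    (hρc : HasCompactSupport ρ) (hF : Measurable F) (hB : ∀ p, |F p| ≤ B) (p : Space N × ℝ) :
    (ρ ⋆[ContinuousLinearMap.lsmul ℝ ℝ, volume] forwardIntegral ε F) p =
      forwardIntegral ε (ρ ⋆[ContinuousLinearMap.lsmul ℝ ℝ, volume] F) p := by
  have hint : Integrable (fun q : ℝ × (Space N × ℝ) => ρ q.2 * F (p + (0, q.1) - q.2))
      ((volume.restrict (Ι 0 ε)).prod volume) := by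
    have h1 : Integrable (fun q : ℝ × (Space N × ℝ) => (1 : ℝ) * ρ q.2)
        ((volume.restrict (Ι 0 ε)).prod volume) :=
      Integrable.mul_prod (f := fun _ : ℝ => (1 : ℝ))
        (integrableOn_const (by simp [uIoc])) (hρ.integrable_of_hasCompactSupport hρc)
    simp only [one_mul] at h1
    refine h1.mul_bdd (c := B) ?_ (Eventually.of_forall fun q => hB _)
    refine (hF.comp ?_).aestronglyMeasurable
    fun_prop
  have h := intervalIntegral_integral_swap (μ := volume) (a := 0) (b := ε)
    (f := fun σ (t : Space N × ℝ) => ρ t * F (p + (0, σ) - t)) hint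
  simp only [convolution_def, forwardIntegral, ContinuousLinearMap.lsmul_apply, smul_eq_mul]
  rw [h]
  refine integral_congr_ae (Eventually.of_forall fun t => ?_)
  beta_reduce
  rw [intervalIntegral.integral_const_mul]
  congr 1
  refine intervalIntegral.integral_congr fun σ _ => ?_
  congr 1
  abel

theorem deriv_forwardIntegral {G : Space N × ℝ → ℝ} (hG : Continuous G) (x : Space N) (s : ℝ) :
    deriv (fun s => forwardIntegral ε G (x, s)) s = G ((x, s) + (0, ε)) - G (x, s) := by
  have hg : Continuous fun t => G (x, t) := hG.comp (by fun_prop)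
  have hi : ∀ a b, IntervalIntegrable (fun t => G (x, t)) volume a b :=
    fun a b => hg.intervalIntegrable a b
  have heq : (fun s => forwardIntegral ε G (x, s)) =
      fun s => (∫ t in (0 : ℝ)..(s + ε), G (x, t)) - ∫ t in (0 : ℝ)..s, G (x, t) := by
    funext s
    rw [forwardIntegral_eq_interval, intervalIntegral.integral_interval_sub_left (hi _ _) (hi _ _)]
  rw [heq]
  have h1 : HasDerivAt (fun s => ∫ t in (0 : ℝ)..s, G (x, t)) (G (x, s)) s :=
    intervalIntegral.integral_hasDerivAt_right (hi _ _)
      (hg.stronglyMeasurableAtFilter _ _) hg.continuousAt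
  have h2 : HasDerivAt (fun s => ∫ t in (0 : ℝ)..s, G (x, t)) (G (x, s + ε)) (s + ε) :=
    intervalIntegral.integral_hasDerivAt_right (hi _ _)
      (hg.stronglyMeasurableAtFilter _ _) hg.continuousAt
  have h3 : HasDerivAt (fun s => ∫ t in (0 : ℝ)..(s + ε), G (x, t)) (G (x, s + ε)) s :=
    h2.comp_add_const s ε
  refine (h3.sub h1).deriv.trans ?_
  simp

end Mollification

section Weak

variable {N : ℕ} {ε B : ℝ} {F : Space N × ℝ → ℝ}

theorem exists_of_convolution_ne_zero {ρ g : Space N × ℝ → ℝ} {p : Space N × ℝ}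
    (h : (ρ ⋆[ContinuousLinearMap.lsmul ℝ ℝ, volume] g) p ≠ 0) : ∃ t, ρ t ≠ 0 ∧ g (p - t) ≠ 0 := by
  by_contra hcon
  push Not at hcon
  refine h ?_
  rw [convolution_def]
  refine integral_eq_zero_of_ae (Eventually.of_forall fun t => ?_)
  by_cases ht : ρ t = 0
  · simp [ht]
  · simp [hcon t ht]

theorem abs_normed_convolution_le (ρ : ContDiffBump (0 : Space N × ℝ)) {g : Space N × ℝ → ℝ}
    (hB : ∀ p, |g p| ≤ B) (p : Space N × ℝ) :
    |(ρ.normed volume ⋆[ContinuousLinearMap.lsmul ℝ ℝ, volume] g) p| ≤ B := by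
  rw [convolution_def]
  have hρ : Integrable (ρ.normed (volume : Measure (Space N × ℝ))) := ρ.integrable_normed
  calc |∫ t, (ContinuousLinearMap.lsmul ℝ ℝ) (ρ.normed volume t) (g (p - t))|
      ≤ ∫ t, |(ContinuousLinearMap.lsmul ℝ ℝ) (ρ.normed volume t) (g (p - t))| :=
        abs_integral_le_integral_abs
    _ ≤ ∫ t, ρ.normed volume t * B := by
        refine integral_mono_of_nonneg (Eventually.of_forall fun t => abs_nonneg _)
          (hρ.mul_const B) (Eventually.of_forall fun t => ?_)
        simp only [ContinuousLinearMap.lsmul_apply, smul_eq_mul, abs_mul]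
        rw [abs_of_nonneg (ρ.nonneg_normed t)]
        exact mul_le_mul_of_nonneg_left (hB _) (ρ.nonneg_normed t)
    _ = B := by rw [integral_mul_const, ρ.integral_normed, one_mul]

theorem normed_convolution_nonneg (ρ : ContDiffBump (0 : Space N × ℝ)) {g : Space N × ℝ → ℝ}
    (h0 : ∀ p, 0 ≤ g p) (p : Space N × ℝ) :
    0 ≤ (ρ.normed volume ⋆[ContinuousLinearMap.lsmul ℝ ℝ, volume] g) p := by
  rw [convolution_def]
  refine integral_nonneg fun t => ?_
  simp only [ContinuousLinearMap.lsmul_apply, smul_eq_mul]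
  exact mul_nonneg (ρ.nonneg_normed t) (h0 _)

theorem tendsto_integral_of_compact_bound {ν : Measure (Space N × ℝ)} {K : Set (Space N × ℝ)}
    {f : ℕ → Space N × ℝ → ℝ} {g : Space N × ℝ → ℝ} (hK : MeasurableSet K) (hKν : ν K < ⊤)
    (hf : ∀ n, AEStronglyMeasurable (f n) ν) (hB : ∀ n p, |f n p| ≤ B)
    (h0 : ∀ n p, f n p ≠ 0 → p ∈ K) (hlim : ∀ᵐ p ∂ν, Tendsto (fun n => f n p) atTop (𝓝 (g p))) :
    Tendsto (fun n => ∫ p, f n p ∂ν) atTop (𝓝 (∫ p, g p ∂ν)) := by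
  refine tendsto_integral_of_dominated_convergence (K.indicator fun _ => B) hf
    ((integrable_indicator_iff hK).2 (integrableOn_const hKν.ne)) ?_ hlim
  intro n
  refine Eventually.of_forall fun p => ?_
  by_cases hp : p ∈ K
  · rw [indicator_of_mem hp]
    exact hB n p
  · have : f n p = 0 := by
      by_contra hne
      exact hp (h0 n p hne)
    simp [this, indicator_of_notMem hp]

/-- The average of `F` has time derivative `F(· + ε) - F`, so integrating by parts turns `∂_t d`
into the backward difference of `d`. Mollification supplies smooth test functions. The limit is
pointwise everywhere on the left, where the measures may be singular and the average is continuous,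
and only almost everywhere on the right, where Lebesgue measure suffices. -/
theorem forwardIntegral_pairing_le {U K : Set (Space N × ℝ)} (hU : IsOpen U)
    {d : Space N × ℝ → ℝ} {μpos μneg : Measure (Space N × ℝ)} (hdm : Measurable d)
    (hd : ∀ K, IsCompact K → K ⊆ U → IntegrableOn d K)
    (hpos : ∀ K, IsCompact K → K ⊆ U → μpos K < ⊤)
    (hneg : ∀ K, IsCompact K → K ⊆ U → μneg K < ⊤)
    (weak : ∀ φ : Space N × ℝ → ℝ, ContDiff ℝ ∞ φ → HasCompactSupport φ → tsupport φ ⊆ U →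
      (∀ p, 0 ≤ φ p) → (∫ p, φ p ∂μpos) - (∫ p, φ p ∂μneg) ≤
        -∫ p, d p * deriv (fun s => φ (p.1, s)) p.2)
    (hε : 0 ≤ ε) (hF : Measurable F) (h0 : ∀ p, 0 ≤ F p) (hB : ∀ p, F p ≤ B) (hK : IsCompact K)
    (hKU : K ⊆ U) (hFK : ∀ p σ, F p ≠ 0 → σ ∈ Icc 0 ε → p - (0, σ) ∈ K)
    (hc : Continuous (forwardIntegral ε F)) :
    (∫ p, forwardIntegral ε F p ∂μpos) - (∫ p, forwardIntegral ε F p ∂μneg) ≤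
      ∫ p, F p * (d p - d (p - (0, ε))) := by
  have hB' : ∀ p, |F p| ≤ B := fun p => by rw [abs_of_nonneg (h0 p)]; exact hB p
  have hB0 : 0 ≤ B := (h0 0).trans (hB 0)
  obtain ⟨δ, hδ, hδU⟩ := hK.exists_cthickening_subset_open hU hKU
  set K2 := Metric.cthickening δ K with hK2def
  have hK2 : IsCompact K2 := hK.cthickening
  have hK2m : MeasurableSet K2 := hK2.isClosed.measurableSet
  -- The ratio of the radii is fixed at 2, as almost everywhere convergence at Lebesgue points
  -- needs; the outer radii stay below `δ`, so all supports remain in `K2 ⊆ U`.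
  let ρ : ℕ → ContDiffBump (0 : Space N × ℝ) := fun n =>
    ⟨δ / (n + 1) / 2, δ / (n + 1), by positivity, half_lt_self (by positivity)⟩
  have hρlim : Tendsto (fun n => (ρ n).rOut) atTop (𝓝 0) :=
    tendsto_const_nhds.div_atTop
      (tendsto_atTop_add_const_right _ _ tendsto_natCast_atTop_atTop)
  have hρle : ∀ n, (ρ n).rOut ≤ δ := fun n => by
    change δ / ((n : ℝ) + 1) ≤ δ
    exact div_le_self hδ.le (by linarith [Nat.cast_nonneg (α := ℝ) n])
  let C : ℕ → (Space N × ℝ → ℝ) → Space N × ℝ → ℝ := fun n g =>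
    ((ρ n).normed volume ⋆[ContinuousLinearMap.lsmul ℝ ℝ, volume] g)
  have hsupp : ∀ n (g : Space N × ℝ → ℝ) p e, (∀ q, g (q + e) ≠ 0 → q ∈ K) → C n g (p + e) ≠ 0 →
      p ∈ K2 := by
    intro n g p e hg hne
    obtain ⟨t, ht, hgt⟩ := exists_of_convolution_ne_zero hne
    have htball : t ∈ Metric.ball (0 : Space N × ℝ) (ρ n).rOut := by
      rw [← (ρ n).support_normed_eq (μ := volume)]
      exact ht
    have hmem : p - t ∈ K := hg _ (by rwa [show p - t + e = p + e - t by abel])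
    refine Metric.mem_cthickening_of_dist_le p (p - t) δ K hmem ?_
    rw [dist_eq_norm, sub_sub_cancel]
    exact (mem_ball_zero_iff.1 htball).le.trans (hρle n)
  have hAK : ∀ q, forwardIntegral ε F (q + 0) ≠ 0 → q ∈ K := by
    intro q hq
    obtain ⟨σ, hσ, hne⟩ := exists_of_forwardIntegral_ne_zero hε hq
    have := hFK _ σ hne hσ
    simpa using this
  have hF0K : ∀ q, F (q + 0) ≠ 0 → q ∈ K := by
    intro q hq
    have := hFK _ 0 hq ⟨le_rfl, hε⟩
    simpa [Prod.mk_zero_zero] using this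
  have hFεK : ∀ q, F (q + (0, ε)) ≠ 0 → q ∈ K := by
    intro q hq
    have := hFK _ ε hq ⟨hε, le_rfl⟩
    simpa using this
  have hFli : LocallyIntegrable F :=
    (integrable_of_bdd_support hF.aestronglyMeasurable hK.measure_lt_top hB'
      (fun x hx => hF0K x (by simpa using hx))).locallyIntegrable
  have hCcont : ∀ n, Continuous (C n F) := fun n =>
    ((ρ n).hasCompactSupport_normed.contDiff_convolution_left (n := 0) _ (ρ n).contDiff_normed
      hFli).continuous
  have hCA : ∀ n p, C n (forwardIntegral ε F) p = forwardIntegral ε (C n F) p := fun n p =>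
    convolution_forwardIntegral (ρ n).continuous_normed (ρ n).hasCompactSupport_normed hF hB' p
  have hCAsmooth : ∀ n, ContDiff ℝ ∞ (C n (forwardIntegral ε F)) := fun n =>
    (ρ n).hasCompactSupport_normed.contDiff_convolution_left _ (ρ n).contDiff_normed
      hc.locallyIntegrable
  have hCAsupp : ∀ n p, C n (forwardIntegral ε F) p ≠ 0 → p ∈ K2 := fun n p hp =>
    hsupp n _ p 0 hAK (by simpa using hp)
  have hCAt : ∀ n, tsupport (C n (forwardIntegral ε F)) ⊆ K2 := fun n =>
    closure_minimal (fun p hp => hCAsupp n p hp) hK2.isClosed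
  have hCAB : ∀ n p, |C n (forwardIntegral ε F) p| ≤ B * ε := fun n p =>
    abs_normed_convolution_le _ (abs_forwardIntegral_le hε hB') p
  have hineq : ∀ n, (∫ p, C n (forwardIntegral ε F) p ∂μpos) -
      (∫ p, C n (forwardIntegral ε F) p ∂μneg) ≤
      -∫ p, d p * (C n F (p + (0, ε)) - C n F p) := by
    intro n
    refine (weak _ (hCAsmooth n) (hK2.of_isClosed_subset (isClosed_tsupport _) (hCAt n))
      ((hCAt n).trans hδU)
      (normed_convolution_nonneg _ (forwardIntegral_nonneg hε h0))).trans_eq ?_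
    congr 1
    refine integral_congr_ae (Eventually.of_forall fun p => ?_)
    beta_reduce
    congr 1
    have : (fun s => C n (forwardIntegral ε F) (p.1, s)) =
        fun s => forwardIntegral ε (C n F) (p.1, s) := funext fun s => hCA n _
    rw [this, deriv_forwardIntegral (hCcont n)]
  have hlimpt : ∀ p, Tendsto (fun n => C n (forwardIntegral ε F) p) atTop
      (𝓝 (forwardIntegral ε F p)) := fun p =>
    ContDiffBump.convolution_tendsto_right_of_continuous hρlim hc p
  have hl1 := tendsto_integral_of_compact_bound hK2m (hpos K2 hK2 hδU)
    (fun n => (hCAsmooth n).continuous.aestronglyMeasurable) hCAB hCAsupp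
    (Eventually.of_forall hlimpt)
  have hl2 := tendsto_integral_of_compact_bound hK2m (hneg K2 hK2 hδU)
    (fun n => (hCAsmooth n).continuous.aestronglyMeasurable) hCAB hCAsupp
    (Eventually.of_forall hlimpt)
  have hae : ∀ᵐ p : Space N × ℝ, Tendsto (fun n => C n F p) atTop (𝓝 (F p)) :=
    ContDiffBump.ae_convolution_tendsto_right_of_locallyIntegrable (K := 2) hρlim
      (Eventually.of_forall fun n => by
        change δ / ((n : ℝ) + 1) ≤ 2 * (δ / (n + 1) / 2)
        linarith) hFli
  have hae' : ∀ᵐ p : Space N × ℝ, Tendsto (fun n => C n F (p + (0, ε))) atTop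
      (𝓝 (F (p + (0, ε)))) :=
    (measurePreserving_add_right volume ((0 : Space N), ε)).quasiMeasurePreserving.ae hae
  have hdK2 : Integrable (K2.indicator fun p => |d p| * (2 * B)) :=
    (integrable_indicator_iff hK2m).2 ((hd K2 hK2 hδU).abs.mul_const _)
  have hCFB : ∀ n p, |C n F p| ≤ B := fun n p => abs_normed_convolution_le _ hB' p
  have hl3 : Tendsto (fun n => ∫ p, d p * (C n F (p + (0, ε)) - C n F p)) atTop
      (𝓝 (∫ p, d p * (F (p + (0, ε)) - F p))) := by
    refine tendsto_integral_of_dominated_convergence _ (fun n => ?_) hdK2 (fun n => ?_) ?_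
    · refine (hdm.mul ?_).aestronglyMeasurable
      have := hCcont n
      exact Continuous.measurable (by fun_prop)
    · refine Eventually.of_forall fun p => ?_
      by_cases hp : p ∈ K2
      · rw [indicator_of_mem hp, Real.norm_eq_abs, abs_mul]
        refine mul_le_mul_of_nonneg_left ?_ (abs_nonneg _)
        have h1 := abs_sub (C n F (p + (0, ε))) (C n F p)
        linarith [hCFB n p, hCFB n (p + (0, ε))]
      · have h1 : C n F p = 0 := by
          by_contra hne
          exact hp (hsupp n F p 0 hF0K (by simpa using hne))
        have h2 : C n F (p + (0, ε)) = 0 := by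
          by_contra hne
          exact hp (hsupp n F p _ hFεK hne)
        simp [h1, h2, indicator_of_notMem hp]
    · filter_upwards [hae, hae'] with p h1 h2
      exact (h2.sub h1).const_mul _
  have hfin := le_of_tendsto_of_tendsto (hl1.sub hl2) hl3.neg (Eventually.of_forall hineq)
  refine hfin.trans_eq ?_
  have hdK : IntegrableOn d K := hd K hK hKU
  have hbd : ∀ g : Space N × ℝ → ℝ, Measurable g → (∀ p, |g p| ≤ B) → (∀ p, g p ≠ 0 → p ∈ K) →
      Integrable fun p => d p * g p := by
    intro g hg hgB hgK
    refine (integrableOn_iff_integrable_of_support_subset (s := K) ?_).1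
      (hdK.mul_bdd (c := B) hg.aestronglyMeasurable (Eventually.of_forall hgB))
    intro p hp
    exact hgK p (right_ne_zero_of_mul hp)
  have hi1 : Integrable fun p => d p * F (p + (0, ε)) :=
    hbd _ (hF.comp (by fun_prop)) (fun p => hB' _) hFεK
  have hi2 : Integrable fun p => d p * F p :=
    hbd _ hF hB' (fun p hp => hF0K p (by simpa using hp))
  -- Translation invariance moves the shift from `F` to `d`.
  have htr := integral_add_right_eq_self (μ := (volume : Measure (Space N × ℝ)))
    (fun p => d (p - (0, ε)) * F p) ((0 : Space N), ε)
  have hi3 : Integrable fun p => d (p - (0, ε)) * F p := by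
    have := hi1.comp_sub_right ((0 : Space N), ε)
    simpa using this
  simp only [add_sub_cancel_right] at htr
  simp only [mul_sub]
  rw [integral_sub hi1 hi2, htr, neg_sub]
  rw [← integral_sub hi2 hi3]
  refine integral_congr_ae (Eventually.of_forall fun p => ?_)
  beta_reduce
  ring

end Weak

/-! ### Measurability of pairings with a measure field. -/

section Field

/-- The field is weakly measurable only against fixed integrands. An integrand that varies with the
base point is frozen on the pieces of a simple approximation of the identity, followed by dominated
convergence. -/
theorem aemeasurable_integral_of_continuous {α Q : Type*} [TopologicalSpace α]
    [SecondCountableTopology α] [TopologicalSpace.PseudoMetrizableSpace α] [MeasurableSpace α]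
    [BorelSpace α] [TopologicalSpace Q] [MeasurableSpace Q] [BorelSpace Q]
    {ν : Measure α} {z : α → Measure Q} {B : ℝ}
    (hz : ∀ f : Q → ℝ, Continuous f → AEMeasurable (fun p => ∫ q, f q ∂(z p)) ν)
    (hm : ∀ᵐ p ∂ν, z p univ ≤ 1) {f : α → Q → ℝ} (hB : ∀ p q, |f p q| ≤ B)
    (hp : ∀ q, Continuous fun p => f p q) (hq : ∀ p, Continuous (f p)) :
    AEMeasurable (fun p => ∫ q, f p q ∂(z p)) ν := by
  have hid : StronglyMeasurable (id : α → α) := measurable_id.stronglyMeasurable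
  refine aemeasurable_of_tendsto_metrizable_ae (u := atTop)
    (f := fun n p => ∫ q, f (hid.approx n p) q ∂(z p)) (fun n => ?_) ?_
  · have heq : (fun p => ∫ q, f (hid.approx n p) q ∂(z p)) = fun p =>
        ∑ c ∈ (hid.approx n).range,
          (hid.approx n ⁻¹' {c}).indicator (fun p => ∫ q, f c q ∂(z p)) p := by
      funext p
      rw [Finset.sum_eq_single (hid.approx n p)]
      · rw [indicator_of_mem]
        exact rfl
      · intro c _ hc
        rw [indicator_of_notMem]
        exact fun h => hc h.symm
      · intro h
        exact absurd (SimpleFunc.mem_range_self _ _) h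
    rw [heq]
    exact Finset.aemeasurable_fun_sum _ fun c _ =>
      (hz _ (hq c)).indicator ((hid.approx n).measurableSet_preimage _)
  · filter_upwards [hm] with p hmp
    have : IsFiniteMeasure (z p) := ⟨hmp.trans_lt ENNReal.one_lt_top⟩
    refine tendsto_integral_of_dominated_convergence (fun _ => B)
      (fun n => (hq _).aestronglyMeasurable) (integrable_const _)
      (fun n => Eventually.of_forall fun q => hB _ q) (Eventually.of_forall fun q => ?_)
    exact ((hp q).tendsto p).comp (hid.tendsto_approx p)

end Field

/-! ### Differentiation of time averages. -/

section Lebesgue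

variable {N : ℕ} {B : ℝ} {F : Space N × ℝ → ℝ}

/-- The exceptional set of times must not depend on `x`. Lebesgue differentiation is applied at a
countable dense set of points, and the uniform Lipschitz bound on the averages carries the limit to
all others. -/
theorem ae_tendsto_forwardIntegral_div (hF : Measurable F) (hB : ∀ p, |F p| ≤ B) {L : ℝ≥0}
    (hL : ∀ t, LipschitzWith L fun x => F (x, t)) {ε : ℕ → ℝ} (hε : ∀ n, 0 < ε n)
    (hlim : Tendsto ε atTop (𝓝 0)) :
    ∀ᵐ s : ℝ, ∀ x : Space N,
      Tendsto (fun n => forwardIntegral (ε n) F (x, s) / ε n) atTop (𝓝 (F (x, s))) := by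
  have hsec : ∀ x, Measurable fun t => F (x, t) := fun x => hF.comp measurable_prodMk_left
  have hli : ∀ x, LocallyIntegrable (fun t => F (x, t)) := fun x =>
    ((locallyIntegrable_const B).mono (hsec x).aestronglyMeasurable
      (Eventually.of_forall fun t => by
        rw [Real.norm_eq_abs, Real.norm_eq_abs, abs_of_nonneg ((abs_nonneg _).trans (hB 0))]
        exact hB _))
  have hii : ∀ x a b, IntervalIntegrable (fun t => F (x, t)) volume a b := fun x a b =>
    intervalIntegrable_iff.mpr
      (((hli x).integrableOn_isCompact isCompact_uIcc).mono_set uIoc_subset_uIcc)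
  have hεlim : Tendsto ε atTop (𝓝[>] 0) :=
    tendsto_nhdsWithin_iff.2 ⟨hlim, Eventually.of_forall hε⟩
  have hae : ∀ᵐ s : ℝ, ∀ k : ℕ, ∀ c, HasDerivAt
      (fun s => ∫ t in c..s, F (TopologicalSpace.denseSeq (Space N) k, t))
      (F (TopologicalSpace.denseSeq (Space N) k, s)) s :=
    ae_all_iff.2 fun k => LocallyIntegrable.ae_hasDerivAt_integral (hli _)
  filter_upwards [hae] with s hs x
  have hk : ∀ k, Tendsto (fun n => forwardIntegral (ε n) F
      (TopologicalSpace.denseSeq (Space N) k, s) / ε n) atTop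
      (𝓝 (F (TopologicalSpace.denseSeq (Space N) k, s))) := by
    intro k
    refine ((hs k 0).tendsto_slope_zero_right.comp hεlim).congr fun n => ?_
    simp only [Function.comp, smul_eq_mul]
    rw [intervalIntegral.integral_interval_sub_left (hii _ _ _) (hii _ _ _),
      forwardIntegral_eq_interval, div_eq_inv_mul]
  have hlip : ∀ x y n, |forwardIntegral (ε n) F (x, s) / ε n -
      forwardIntegral (ε n) F (y, s) / ε n| ≤ L * dist x y := by
    intro x y n
    rw [← sub_div, abs_div, abs_of_pos (hε n), div_le_iff₀ (hε n), forwardIntegral_eq_interval,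
      forwardIntegral_eq_interval]
    simp only
    rw [← intervalIntegral.integral_sub (hii _ _ _) (hii _ _ _)]
    have := intervalIntegral.norm_integral_le_of_norm_le_const (a := s) (b := s + ε n)
      (C := L * dist x y) (f := fun t => F (x, t) - F (y, t)) (fun t _ => (hL t).dist_le_mul x y)
    simpa [abs_of_pos (hε n)] using this
  rw [Metric.tendsto_atTop]
  intro e he
  obtain ⟨y, hy, k, rfl⟩ := Metric.dense_iff.1 (TopologicalSpace.denseRange_denseSeq (Space N)) x
    (e / (3 * (L + 1))) (by positivity)
  have hd : L * dist x (TopologicalSpace.denseSeq (Space N) k) ≤ e / 3 := by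
    have h1 : dist x (TopologicalSpace.denseSeq (Space N) k) ≤ e / (3 * (L + 1)) := by
      rw [dist_comm]
      exact (Metric.mem_ball.1 hy).le
    calc (L : ℝ) * dist x (TopologicalSpace.denseSeq (Space N) k)
        ≤ (L + 1) * (e / (3 * (L + 1))) :=
          mul_le_mul (by linarith) h1 dist_nonneg (by positivity)
      _ = e / 3 := by field_simp
  obtain ⟨n₀, hn₀⟩ := Metric.tendsto_atTop.1 (hk k) (e / 3) (by positivity)
  refine ⟨n₀, fun n hn => ?_⟩
  have h1 := hlip x (TopologicalSpace.denseSeq (Space N) k) n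
  have h2 := hn₀ n hn
  have h3 := (hL s).dist_le_mul x (TopologicalSpace.denseSeq (Space N) k)
  rw [Real.dist_eq] at h2 h3 ⊢
  rw [abs_le] at h1 h3
  rw [abs_lt] at h2 ⊢
  constructor <;> linarith [h1.1, h1.2, h2.1, h2.2, h3.1, h3.2]

end Lebesgue

/-! ### Fields attaining the oscillation, and their monotonicity. -/

section Oscillation

variable {N : ℕ} {r : ℝ}

/-- The oscillation is taken over the open ball while `C_r` is built from closed balls; for
continuous functions an essential bound holds everywhere on the open ball, and then on its closure.
-/
theorem le_essSup_of_mem_closedBall (hr : 0 < r) {v : Space N → ℝ} (hv : Continuous v)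
    {w x : Space N} (hx : x ∈ Metric.closedBall w r) :
    v x ≤ essSup v (volume.restrict (Metric.ball w r)) := by
  obtain ⟨M, hM⟩ := (isCompact_closedBall w r).bddAbove_image hv.continuousOn
  have hbd : IsBoundedUnder (· ≤ ·) (ae (volume.restrict (Metric.ball w r))) v :=
    ⟨M, by
      rw [eventually_map]
      filter_upwards [ae_restrict_mem measurableSet_ball] with y hy
      exact hM ⟨y, Metric.ball_subset_closedBall hy, rfl⟩⟩
  have hae := ae_le_essSup hbd
  rw [ae_restrict_iff' measurableSet_ball, ae_iff] at hae
  have hopen : IsOpen (Metric.ball w r ∩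
      {y | essSup v (volume.restrict (Metric.ball w r)) < v y}) :=
    Metric.isOpen_ball.inter (isOpen_lt continuous_const hv)
  have hempty := hopen.eq_empty_of_measure_zero (μ := volume) (by
    convert hae using 2
    ext y
    simp)
  have hball : Metric.ball w r ⊆ {y | v y ≤ essSup v (volume.restrict (Metric.ball w r))} := by
    intro y hy
    by_contra hcon
    have hlt : essSup v (volume.restrict (Metric.ball w r)) < v y := not_le.1 hcon
    exact (hempty.subset ⟨hy, hlt⟩ : y ∈ (∅ : Set (Space N)))
  have := closure_minimal hball (isClosed_le hv continuous_const)
  rw [closure_ball w hr.ne'] at this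
  exact this hx

theorem essInf_le_of_mem_closedBall (hr : 0 < r) {v : Space N → ℝ} (hv : Continuous v)
    {w x : Space N} (hx : x ∈ Metric.closedBall w r) :
    essInf v (volume.restrict (Metric.ball w r)) ≤ v x := by
  obtain ⟨M, hM⟩ := (isCompact_closedBall w r).bddBelow_image hv.continuousOn
  have hbd : IsBoundedUnder (· ≥ ·) (ae (volume.restrict (Metric.ball w r))) v :=
    ⟨M, by
      rw [eventually_map]
      filter_upwards [ae_restrict_mem measurableSet_ball] with y hy
      exact hM ⟨y, Metric.ball_subset_closedBall hy, rfl⟩⟩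
  have hae := ae_essInf_le hbd
  rw [ae_restrict_iff' measurableSet_ball, ae_iff] at hae
  have hopen : IsOpen (Metric.ball w r ∩
      {y | v y < essInf v (volume.restrict (Metric.ball w r))}) :=
    Metric.isOpen_ball.inter (isOpen_lt hv continuous_const)
  have hempty := hopen.eq_empty_of_measure_zero (μ := volume) (by
    convert hae using 2
    ext y
    simp)
  have hball : Metric.ball w r ⊆ {y | essInf v (volume.restrict (Metric.ball w r)) ≤ v y} := by
    intro y hy
    by_contra hcon
    have hlt : v y < essInf v (volume.restrict (Metric.ball w r)) := not_le.1 hcon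
    exact (hempty.subset ⟨hy, hlt⟩ : y ∈ (∅ : Set (Space N)))
  have := closure_minimal hball (isClosed_le continuous_const hv)
  rw [closure_ball w hr.ne'] at this
  exact this hx

/-- The measure `ζ` on `C_r` has mass at most one and attains the oscillation of `v` on the ball of
centre `w`. -/
def AttainsOsc (r : ℝ) (v : Space N → ℝ) (w : Space N) (ζ : Measure (Space N × Space N)) : Prop :=
  ζ univ ≤ 1 ∧ ζ (Cr N r)ᶜ = 0 ∧
    ∫ q, (v (w + q.1) - v (w + q.2)) ∂ζ = essOsc (Metric.ball w r) v

theorem integrable_of_continuous {ζ : Measure (Space N × Space N)} [IsFiniteMeasure ζ]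
    (hζ : ζ (Cr N r)ᶜ = 0) {h : Space N × Space N → ℝ} (hh : Continuous h) : Integrable h ζ := by
  have hK : IsCompact (Cr N r) := (isCompact_closedBall _ _).prod (isCompact_closedBall _ _)
  have hae : ∀ᵐ q ∂ζ, q ∈ Cr N r := hζ
  have := hh.continuousOn.integrableOn_compact (μ := ζ) hK
  rwa [IntegrableOn, Measure.restrict_eq_self_of_ae_mem hae] at this

/-- Each difference is at most `S - I` and the mass is at most one, so reaching `S - I` in the
integral forces equality almost everywhere, and forces full mass unless `S = I`. -/
theorem AttainsOsc.exists_ae_eq (hr : 0 < r) {v : Space N → ℝ} (hv : Continuous v) {w : Space N}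
    {ζ : Measure (Space N × Space N)} (h : AttainsOsc r v w ζ) :
    ∃ S I : ℝ, I ≤ S ∧ (∀ x ∈ Metric.closedBall (0 : Space N) r, I ≤ v (w + x) ∧ v (w + x) ≤ S) ∧
      (∀ᵐ q ∂ζ, q ∈ Cr N r ∧ v (w + q.1) = S ∧ v (w + q.2) = I) ∧ ζ.real univ ≤ 1 ∧
      (I < S → ζ.real univ = 1) := by
  obtain ⟨hm, hζ, hint⟩ := h
  have : IsFiniteMeasure ζ := ⟨hm.trans_lt ENNReal.one_lt_top⟩
  set S := essSup v (volume.restrict (Metric.ball w r)) with hS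
  set I := essInf v (volume.restrict (Metric.ball w r)) with hI
  have hint' : ∫ q, (v (w + q.1) - v (w + q.2)) ∂ζ = S - I := hint
  have hmem : ∀ x ∈ Metric.closedBall (0 : Space N) r, w + x ∈ Metric.closedBall w r := by
    intro x hx
    simpa [dist_eq_norm] using hx
  have hbd : ∀ x ∈ Metric.closedBall (0 : Space N) r, I ≤ v (w + x) ∧ v (w + x) ≤ S := fun x hx =>
    ⟨essInf_le_of_mem_closedBall hr hv (hmem x hx), le_essSup_of_mem_closedBall hr hv (hmem x hx)⟩
  have hIS : I ≤ S := by
    have := hbd 0 (Metric.mem_closedBall_self hr.le)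
    exact this.1.trans this.2
  have hmr : ζ.real univ ≤ 1 := ENNReal.toReal_le_of_le_ofReal zero_le_one (by simpa using hm)
  have haem : ∀ᵐ q ∂ζ, q ∈ Cr N r := hζ
  have hcont : Continuous fun q : Space N × Space N => v (w + q.1) - v (w + q.2) := by fun_prop
  have hi := integrable_of_continuous hζ hcont
  have hi2 : Integrable (fun q : Space N × Space N => (S - I) - (v (w + q.1) - v (w + q.2))) ζ :=
    (integrable_const _).sub hi
  have hnn : 0 ≤ᵐ[ζ] fun q : Space N × Space N => (S - I) - (v (w + q.1) - v (w + q.2)) := by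
    filter_upwards [haem] with q hq
    have h1 := hbd q.1 hq.1
    have h2 := hbd q.2 hq.2
    simp only [Pi.zero_apply]
    linarith [h1.2, h2.1]
  have hval : ∫ q, ((S - I) - (v (w + q.1) - v (w + q.2))) ∂ζ =
      (S - I) * (ζ.real univ - 1) := by
    rw [integral_sub (integrable_const _) hi, hint', integral_const, smul_eq_mul]
    ring
  have hge := integral_nonneg_of_ae hnn
  rw [hval] at hge
  have hz0 : (S - I) * (ζ.real univ - 1) = 0 :=
    le_antisymm (mul_nonpos_of_nonneg_of_nonpos (by linarith) (by linarith)) hge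
  refine ⟨S, I, hIS, hbd, ?_, hmr, fun hlt => ?_⟩
  · have h0 := (integral_eq_zero_iff_of_nonneg_ae hnn hi2).1 (hval.trans hz0)
    filter_upwards [h0, haem] with q hq0 hq
    have h1 := hbd q.1 hq.1
    have h2 := hbd q.2 hq.2
    simp only [Pi.zero_apply] at hq0
    exact ⟨hq, by linarith [h1.2, h2.1], by linarith [h1.2, h2.1]⟩
  · rcases mul_eq_zero.1 hz0 with h | h <;> linarith

theorem integral_le_of_ae_le {ζ : Measure (Space N × Space N)} [IsFiniteMeasure ζ]
    {h : Space N × Space N → ℝ} (hi : Integrable h ζ) {c : ℝ} (hc : ∀ᵐ q ∂ζ, h q ≤ c) :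
    ∫ q, h q ∂ζ ≤ c * ζ.real univ := by
  have := integral_mono_ae hi (integrable_const c) hc
  rw [integral_const, smul_eq_mul] at this
  linarith

/-- The monotonicity underlying the comparison: testing the sum of the two nonlocal divergences
with a function that is nonincreasing in both distances. -/
theorem AttainsOsc.integral_add_nonpos (hr : 0 < r) {a b : Space N → ℝ} (ha : Continuous a)
    (hb : Continuous b) {w : Space N} {ζ₁ ζ₂ : Measure (Space N × Space N)}
    (h₁ : AttainsOsc r a w ζ₁) (h₂ : AttainsOsc r b w ζ₂) {γ : ℝ → ℝ → ℝ}
    (hγ₁ : ∀ y, Antitone fun x => γ x y) (hγ₂ : ∀ x, Antitone (γ x))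
    (hγ : Continuous fun x => γ (a x) (b x)) :
    (∫ q, (γ (a (w + q.1)) (b (w + q.1)) - γ (a (w + q.2)) (b (w + q.2))) ∂ζ₁) +
      ∫ q, (γ (a (w + q.1)) (b (w + q.1)) - γ (a (w + q.2)) (b (w + q.2))) ∂ζ₂ ≤ 0 := by
  obtain ⟨S₁, I₁, hIS₁, hbd₁, hae₁, hm₁, hone₁⟩ := h₁.exists_ae_eq hr ha
  obtain ⟨S₂, I₂, hIS₂, hbd₂, hae₂, hm₂, hone₂⟩ := h₂.exists_ae_eq hr hb
  have : IsFiniteMeasure ζ₁ := ⟨h₁.1.trans_lt ENNReal.one_lt_top⟩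
  have : IsFiniteMeasure ζ₂ := ⟨h₂.1.trans_lt ENNReal.one_lt_top⟩
  have hcont : Continuous fun q : Space N × Space N =>
      γ (a (w + q.1)) (b (w + q.1)) - γ (a (w + q.2)) (b (w + q.2)) :=
    (hγ.comp (by fun_prop : Continuous fun q : Space N × Space N => w + q.1)).sub
      (hγ.comp (by fun_prop : Continuous fun q : Space N × Space N => w + q.2))
  have hb₁ := integral_le_of_ae_le (integrable_of_continuous h₁.2.1 hcont)
    (c := γ S₁ I₂ - γ I₁ S₂) (by
      filter_upwards [hae₁] with q hq
      rw [hq.2.1, hq.2.2]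
      have e1 := hγ₂ S₁ (hbd₂ q.1 hq.1.1).1
      have e2 := hγ₂ I₁ (hbd₂ q.2 hq.1.2).2
      linarith)
  have hb₂ := integral_le_of_ae_le (integrable_of_continuous h₂.2.1 hcont)
    (c := γ I₁ S₂ - γ S₁ I₂) (by
      filter_upwards [hae₂] with q hq
      rw [hq.2.1, hq.2.2]
      have e1 := hγ₁ S₂ (hbd₁ q.1 hq.1.1).1
      have e2 := hγ₁ I₂ (hbd₁ q.2 hq.1.2).2
      simp only at e1 e2
      linarith)
  -- The two bounds are opposite multiples of one number. If it is negative, `a` cannot be constant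
  -- on the ball and `ζ₁` has mass one; if it is positive, the same holds for `b` and `ζ₂`.
  have hkey : (γ S₁ I₂ - γ I₁ S₂) * (ζ₁.real univ - ζ₂.real univ) ≤ 0 := by
    rcases lt_trichotomy (γ S₁ I₂) (γ I₁ S₂) with h | h | h
    · have hlt : I₁ < S₁ := by
        by_contra hcon
        have heq : I₁ = S₁ := le_antisymm hIS₁ (not_lt.1 hcon)
        have := hγ₂ S₁ hIS₂
        rw [heq] at h
        linarith
      have := hone₁ hlt
      nlinarith
    · rw [h]
      simp
    · have hlt : I₂ < S₂ := by
        by_contra hcon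
        have heq : I₂ = S₂ := le_antisymm hIS₂ (not_lt.1 hcon)
        have := hγ₁ S₂ hIS₁
        simp only at this
        rw [heq] at h
        linarith
      have := hone₂ hlt
      nlinarith
  nlinarith

end Oscillation

/-! ### Smooth truncation. -/

section Truncation

/-- A smooth convex approximation of the positive part. -/
noncomputable def softPos (κ v : ℝ) : ℝ := (v + √(v ^ 2 + κ ^ 2)) / 2

/-- The derivative of `softPos`. -/
noncomputable def softStep (κ v : ℝ) : ℝ := (1 + v / √(v ^ 2 + κ ^ 2)) / 2

variable {κ : ℝ}

theorem abs_le_sqrt_sq_add_sq (κ v : ℝ) : |v| ≤ √(v ^ 2 + κ ^ 2) :=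
  Real.abs_le_sqrt (by nlinarith [sq_nonneg κ])

theorem sqrt_sq_add_sq_pos (hκ : 0 < κ) (v : ℝ) : 0 < √(v ^ 2 + κ ^ 2) :=
  Real.sqrt_pos.2 (by positivity)

theorem le_softPos (κ v : ℝ) : v ≤ softPos κ v := by
  have := (le_abs_self v).trans (abs_le_sqrt_sq_add_sq κ v)
  unfold softPos
  linarith

theorem softPos_nonneg (κ v : ℝ) : 0 ≤ softPos κ v := by
  have := (neg_le_abs v).trans (abs_le_sqrt_sq_add_sq κ v)
  unfold softPos
  linarith

theorem softPos_le (hκ : 0 < κ) (v : ℝ) : softPos κ v ≤ max v 0 + κ := by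
  have h1 : √(v ^ 2 + κ ^ 2) ≤ |v| + κ := by
    rw [Real.sqrt_le_left (by positivity)]
    nlinarith [abs_nonneg v, sq_abs v]
  unfold softPos
  rcases le_total v 0 with h | h
  · rw [max_eq_right h]
    rw [abs_of_nonpos h] at h1
    linarith
  · rw [max_eq_left h]
    rw [abs_of_nonneg h] at h1
    linarith

theorem softStep_nonneg (hκ : 0 < κ) (v : ℝ) : 0 ≤ softStep κ v := by
  have h := sqrt_sq_add_sq_pos hκ v
  have h2 : -1 ≤ v / √(v ^ 2 + κ ^ 2) := by
    rw [le_div_iff₀ h]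
    linarith [(neg_le_abs v).trans (abs_le_sqrt_sq_add_sq κ v)]
  unfold softStep
  linarith

theorem softStep_le_one (hκ : 0 < κ) (v : ℝ) : softStep κ v ≤ 1 := by
  have h := sqrt_sq_add_sq_pos hκ v
  have h2 : v / √(v ^ 2 + κ ^ 2) ≤ 1 := by
    rw [div_le_iff₀ h]
    linarith [(le_abs_self v).trans (abs_le_sqrt_sq_add_sq κ v)]
  unfold softStep
  linarith

theorem continuous_softPos (κ : ℝ) : Continuous (softPos κ) := by
  unfold softPos
  fun_prop

theorem continuous_softStep (hκ : 0 < κ) : Continuous (softStep κ) := by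
  unfold softStep
  refine Continuous.div_const (continuous_const.add ?_) 2
  exact continuous_id.div (by fun_prop) fun v => (sqrt_sq_add_sq_pos hκ v).ne'

/-- The graph of the convex function `softPos` lies above its tangents; this reduces to the
Cauchy-Schwarz inequality for `(a, κ)` and `(b, κ)`. -/
theorem softStep_mul_le (hκ : 0 < κ) (a b : ℝ) :
    softStep κ a * (b - a) ≤ softPos κ b - softPos κ a := by
  have ha := sqrt_sq_add_sq_pos hκ a
  have hb := sqrt_sq_add_sq_pos hκ b
  have hsa : √(a ^ 2 + κ ^ 2) ^ 2 = a ^ 2 + κ ^ 2 := Real.sq_sqrt (by positivity)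
  have hsb : √(b ^ 2 + κ ^ 2) ^ 2 = b ^ 2 + κ ^ 2 := Real.sq_sqrt (by positivity)
  have hcs : a * b + κ ^ 2 ≤ √(a ^ 2 + κ ^ 2) * √(b ^ 2 + κ ^ 2) := by
    rw [← Real.sqrt_mul (by positivity)]
    refine Real.le_sqrt_of_sq_le ?_
    nlinarith [mul_nonneg (sq_nonneg (a - b)) (sq_nonneg κ)]
  have hkey : a / √(a ^ 2 + κ ^ 2) * (b - a) ≤ √(b ^ 2 + κ ^ 2) - √(a ^ 2 + κ ^ 2) := by
    rw [div_mul_eq_mul_div, div_le_iff₀ ha]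
    nlinarith
  unfold softPos softStep
  linarith

theorem softPos_mono (hκ : 0 < κ) : Monotone (softPos κ) := fun a b hab => by
  have h1 := softStep_mul_le hκ a b
  have h2 := mul_nonneg (softStep_nonneg hκ a) (sub_nonneg.2 hab)
  linarith

theorem abs_softPos_sub_le (hκ : 0 < κ) (a b : ℝ) : |softPos κ a - softPos κ b| ≤ |a - b| := by
  wlog hab : a ≤ b generalizing a b
  · rw [abs_sub_comm, abs_sub_comm a]
    exact this b a (le_of_not_ge hab)
  · have h1 := softPos_mono hκ hab
    have h2 := softStep_mul_le hκ b a
    have h3 := softStep_le_one hκ b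
    rw [abs_of_nonpos (by linarith), abs_of_nonpos (by linarith)]
    nlinarith

end Truncation

variable {N : ℕ}

/-- The hypotheses on a distance function `d` and a field `z` on `U × (a, b)` that are used in the
comparison argument. -/
structure IsLocalSupersolution (r : ℝ) (C : ℝ≥0) (U : Set (Space N)) (a b : ℝ)
    (d : Space N × ℝ → ℝ) (z : Space N × ℝ → Measure (Space N × Space N))
    (μpos μneg : Measure (Space N × ℝ)) : Prop where
  isOpen : IsOpen U
  measurable : Measurable d
  nonneg : ∀ p, 0 ≤ d p
  lipschitz : ∀ s, LipschitzWith 1 fun x => d (x, s)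
  left : ∀ s ∈ Ioo a b, ∀ x, Tendsto (fun s => d (x, s)) (𝓝[<] s) (𝓝 (d (x, s)))
  integrable : ∀ K, IsCompact K → K ⊆ U ×ˢ Ioo a b → IntegrableOn d K
  finite_pos : ∀ K, IsCompact K → K ⊆ U ×ˢ Ioo a b → μpos K < ⊤
  finite_neg : ∀ K, IsCompact K → K ⊆ U ×ˢ Ioo a b → μneg K < ⊤
  weak : ∀ φ : Space N × ℝ → ℝ, ContDiff ℝ ∞ φ → HasCompactSupport φ →
    tsupport φ ⊆ U ×ˢ Ioo a b → (∀ p, 0 ≤ φ p) → (∫ p, φ p ∂μpos) - (∫ p, φ p ∂μneg) ≤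
      -∫ p, d p * deriv (fun s => φ (p.1, s)) p.2
  pairing : ∀ φ : Space N × ℝ → ℝ, Continuous φ → HasCompactSupport φ →
    tsupport φ ⊆ U ×ˢ Ioo a b → (∫ p, φ p ∂μpos) - (∫ p, φ p ∂μneg) =
      -(1 / (2 * r)) * ∫ p in univ ×ˢ Ioo a b,
        (∫ q, (φ (p.1 + q.1, p.2) - φ (p.1 + q.2, p.2)) ∂(z p))
  bound : μpos.restrict (U ×ˢ Ioo a b) ≤ C • volume
  field_measurable : ∀ f : Space N × Space N → ℝ, Continuous f →
    AEMeasurable (fun p => ∫ q, f q ∂(z p)) (volume.restrict (univ ×ˢ Ioo a b))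
  field : ∀ᵐ p ∂(volume.restrict (univ ×ˢ Ioo a b)),
    AttainsOsc r (fun x => d (x, p.2)) p.1 (z p)

/-! ### The differential inequality with a mixed weight. -/

section Local

variable {r : ℝ} {C : ℝ≥0} {U K : Set (Space N)} {a b t₁ t₂ ε B : ℝ} {d : Space N × ℝ → ℝ}
  {z : Space N × ℝ → Measure (Space N × Space N)} {μpos μneg : Measure (Space N × ℝ)}
  {f θ : Space N × ℝ → ℝ}

theorem sub_mem_of_ne_zero (hf : ∀ p, f p ≠ 0 → p ∈ K ×ˢ Ioc t₁ t₂) {p : Space N × ℝ} {σ : ℝ}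
    (hp : f p ≠ 0) (hσ : σ ∈ Icc 0 ε) : p - (0, σ) ∈ K ×ˢ Icc (t₁ - ε) t₂ := by
  obtain ⟨h1, h2⟩ := hf p hp
  refine ⟨by simpa using h1, ?_⟩
  simp only [Prod.snd_sub, mem_Icc]
  constructor <;> linarith [h2.1, h2.2, hσ.1, hσ.2]

theorem mem_of_forwardIntegral_ne_zero (hε : 0 ≤ ε) (hf : ∀ p, f p ≠ 0 → p ∈ K ×ˢ Ioc t₁ t₂)
    {p : Space N × ℝ} (hp : forwardIntegral ε f p ≠ 0) : p ∈ K ×ˢ Icc (t₁ - ε) t₂ := by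
  obtain ⟨σ, hσ, hne⟩ := exists_of_forwardIntegral_ne_zero hε hp
  simpa using sub_mem_of_ne_zero hf hne hσ

theorem IsLocalSupersolution.integrable_difference
    (h : IsLocalSupersolution r C U a b d z μpos μneg) (hε : 0 ≤ ε) (ha : a < t₁ - ε) (hb : t₂ < b)
    (hK : IsCompact K) (hKU : K ⊆ U) (hfm : Measurable f) (hfB : ∀ p, |f p| ≤ B)
    (hf : ∀ p, f p ≠ 0 → p ∈ K ×ˢ Ioc t₁ t₂) :
    Integrable fun p => f p * (d p - d (p - (0, ε))) := by
  have hK' : IsCompact (K ×ˢ Icc (t₁ - ε) t₂) := hK.prod isCompact_Icc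
  have hK'U : K ×ˢ Icc (t₁ - ε) t₂ ⊆ U ×ˢ Ioo a b :=
    prod_mono hKU fun t ht => ⟨ha.trans_le ht.1, ht.2.trans_lt hb⟩
  have hbd : ∀ g : Space N × ℝ → ℝ, Measurable g → (∀ p, |g p| ≤ B) →
      (∀ p, g p ≠ 0 → p ∈ K ×ˢ Icc (t₁ - ε) t₂) → Integrable fun p => d p * g p := by
    intro g hg hgB hgK
    refine (integrableOn_iff_integrable_of_support_subset (s := K ×ˢ Icc (t₁ - ε) t₂) ?_).1
      ((h.integrable _ hK' hK'U).mul_bdd (c := B) hg.aestronglyMeasurable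
        (Eventually.of_forall hgB))
    intro p hp
    exact hgK p (right_ne_zero_of_mul hp)
  have h1 := hbd f hfm hfB fun p hp => by
    have := sub_mem_of_ne_zero (σ := 0) hf hp ⟨le_rfl, hε⟩
    simpa [Prod.mk_zero_zero] using this
  have h2 := hbd (fun p => f (p + (0, ε))) (hfm.comp (by fun_prop)) (fun p => hfB _) fun p hp => by
    have := sub_mem_of_ne_zero hf hp ⟨hε, le_rfl⟩
    simpa using this
  have h3 := h2.comp_sub_right ((0 : Space N), ε)
  simp only [sub_add_cancel] at h3
  refine (h1.sub h3).congr (Eventually.of_forall fun p => ?_)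
  simp only [Pi.sub_apply]
  ring

/-- The test function splits as `f θ + f (1 - θ)`. The first part uses the weak inequality, the
second only the bound `C` on the density of the positive part, the negative part being discarded.
Both averages must be continuous, so `θ` has to be continuous in space; this is why the truncation
is smooth. -/
theorem IsLocalSupersolution.pairing_forwardIntegral_le
    (h : IsLocalSupersolution r C U a b d z μpos μneg) (hε : 0 ≤ ε) (ha : a < t₁ - ε) (hb : t₂ < b)
    (hK : IsCompact K) (hKU : K ⊆ U) (hfm : Measurable f) (hf0 : ∀ p, 0 ≤ f p)
    (hfB : ∀ p, f p ≤ B) (hfc : ∀ t, Continuous fun x => f (x, t))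
    (hf : ∀ p, f p ≠ 0 → p ∈ K ×ˢ Ioc t₁ t₂) (hθm : Measurable θ) (hθ0 : ∀ p, 0 ≤ θ p)
    (hθ1 : ∀ p, θ p ≤ 1) (hθc : ∀ t, Continuous fun x => θ (x, t)) :
    Integrable (fun p => f p * (C * ε * (1 - θ p) + θ p * (d p - d (p - (0, ε))))) ∧
    -(1 / (2 * r)) * ∫ p in univ ×ˢ Ioo a b, (∫ q, (forwardIntegral ε f (p.1 + q.1, p.2) -
        forwardIntegral ε f (p.1 + q.2, p.2)) ∂(z p)) ≤
      ∫ p, f p * (C * ε * (1 - θ p) + θ p * (d p - d (p - (0, ε)))) := by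
  set K' := K ×ˢ Icc (t₁ - ε) t₂ with hK'def
  have hK' : IsCompact K' := hK.prod isCompact_Icc
  have hK'U : K' ⊆ U ×ˢ Ioo a b :=
    prod_mono hKU fun t ht => ⟨ha.trans_le ht.1, ht.2.trans_lt hb⟩
  let F : Space N × ℝ → ℝ := fun p => f p * θ p
  let G : Space N × ℝ → ℝ := fun p => f p * (1 - θ p)
  have hFm : Measurable F := hfm.mul hθm
  have hGm : Measurable G := hfm.mul (measurable_const.sub hθm)
  have hF0 : ∀ p, 0 ≤ F p := fun p => mul_nonneg (hf0 p) (hθ0 p)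
  have hG0 : ∀ p, 0 ≤ G p := fun p => mul_nonneg (hf0 p) (by linarith [hθ1 p])
  have hFB : ∀ p, F p ≤ B := fun p => (mul_le_of_le_one_right (hf0 p) (hθ1 p)).trans (hfB p)
  have hGB : ∀ p, G p ≤ B := fun p =>
    (mul_le_of_le_one_right (hf0 p) (by linarith [hθ0 p])).trans (hfB p)
  have habs : ∀ {g : Space N × ℝ → ℝ}, (∀ p, 0 ≤ g p) → (∀ p, g p ≤ B) → ∀ p, |g p| ≤ B :=
    fun h0 h1 p => by rw [abs_of_nonneg (h0 p)]; exact h1 p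
  have hFs : ∀ p, F p ≠ 0 → p ∈ K ×ˢ Ioc t₁ t₂ := fun p hp => hf p (left_ne_zero_of_mul hp)
  have hGs : ∀ p, G p ≠ 0 → p ∈ K ×ˢ Ioc t₁ t₂ := fun p hp => hf p (left_ne_zero_of_mul hp)
  have hAf := continuous_forwardIntegral hε hfm (habs hf0 hfB) hfc
  have hAF := continuous_forwardIntegral hε hFm (habs hF0 hFB) fun t => (hfc t).mul (hθc t)
  have hAG := continuous_forwardIntegral hε hGm (habs hG0 hGB)
    fun t => (hfc t).mul (continuous_const.sub (hθc t))
  have hmemK : ∀ {p : Space N × ℝ}, p ∈ K ×ˢ Ioc t₁ t₂ → p ∈ K' := fun {p} hp =>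
    ⟨hp.1, by linarith [hp.2.1], hp.2.2⟩
  have hint : ∀ {g : Space N × ℝ → ℝ} {ν : Measure (Space N × ℝ)}, ν K' < ⊤ → (∀ p, 0 ≤ g p) →
      (∀ p, g p ≤ B) → (∀ p, g p ≠ 0 → p ∈ K ×ˢ Ioc t₁ t₂) → Continuous (forwardIntegral ε g) →
      Integrable (forwardIntegral ε g) ν := fun hν h0 h1 h2 h3 =>
    integrable_of_bdd_support h3.aestronglyMeasurable hν
      (abs_forwardIntegral_le hε (habs h0 h1)) fun p hp => mem_of_forwardIntegral_ne_zero hε h2 hp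
  have hFi : Integrable F := integrable_of_bdd_support hFm.aestronglyMeasurable
    hK'.measure_lt_top (habs hF0 hFB) fun p hp => hmemK (hFs p hp)
  have hGi : Integrable G := integrable_of_bdd_support hGm.aestronglyMeasurable
    hK'.measure_lt_top (habs hG0 hGB) fun p hp => hmemK (hGs p hp)
  have hsec : ∀ {g : Space N × ℝ → ℝ}, Measurable g → (∀ p, 0 ≤ g p) → (∀ p, g p ≤ B) →
      ∀ p : Space N × ℝ, IntervalIntegrable (fun σ => g (p + (0, σ))) volume 0 ε := by
    intro g hg h0 h1 p
    rw [intervalIntegrable_iff]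
    exact IntegrableOn.of_bound (by simp [uIoc])
      (hg.comp (by fun_prop)).aestronglyMeasurable B (Eventually.of_forall fun σ => habs h0 h1 _)
  have hsplit : forwardIntegral ε f = fun p => forwardIntegral ε F p + forwardIntegral ε G p := by
    funext p
    simp only [forwardIntegral]
    rw [← intervalIntegral.integral_add (hsec hFm hF0 hFB p) (hsec hGm hG0 hGB p)]
    refine intervalIntegral.integral_congr fun σ _ => ?_
    simp only [F, G]
    ring
  have hts : tsupport (forwardIntegral ε f) ⊆ K' :=
    closure_minimal (fun p hp => mem_of_forwardIntegral_ne_zero hε hf hp) hK'.isClosed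
  have hpair := h.pairing _ hAf (hK'.of_isClosed_subset (isClosed_tsupport _) hts)
    (hts.trans hK'U)
  have hμp := h.finite_pos K' hK' hK'U
  have hμn := h.finite_neg K' hK' hK'U
  have hp1 : ∫ p, forwardIntegral ε f p ∂μpos =
      (∫ p, forwardIntegral ε F p ∂μpos) + ∫ p, forwardIntegral ε G p ∂μpos := by
    rw [hsplit]
    exact integral_add (hint hμp hF0 hFB hFs hAF) (hint hμp hG0 hGB hGs hAG)
  have hn1 : ∫ p, forwardIntegral ε f p ∂μneg =
      (∫ p, forwardIntegral ε F p ∂μneg) + ∫ p, forwardIntegral ε G p ∂μneg := by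
    rw [hsplit]
    exact integral_add (hint hμn hF0 hFB hFs hAF) (hint hμn hG0 hGB hGs hAG)
  have hnG : 0 ≤ ∫ p, forwardIntegral ε G p ∂μneg :=
    integral_nonneg (forwardIntegral_nonneg hε hG0)
  have hpG : ∫ p, forwardIntegral ε G p ∂μpos ≤ C * (ε * ∫ p, G p) := by
    rw [← integral_forwardIntegral hGm hGi]
    have h0 : ∀ p, p ∉ U ×ˢ Ioo a b → forwardIntegral ε G p = 0 := fun p hp => by
      by_contra hne
      exact hp (hK'U (mem_of_forwardIntegral_ne_zero hε hGs hne))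
    rw [← setIntegral_eq_integral_of_forall_compl_eq_zero h0]
    have hGv : Integrable (forwardIntegral ε G) :=
      hint hK'.measure_lt_top hG0 hGB hGs hAG
    refine (integral_mono_measure h.bound
      (Eventually.of_forall (forwardIntegral_nonneg hε hG0)) ?_).trans_eq ?_
    · exact hGv.smul_measure_nnreal
    · rw [integral_smul_nnreal_measure]
      rfl
  have hweak := forwardIntegral_pairing_le (h.isOpen.prod isOpen_Ioo) h.measurable h.integrable
    h.finite_pos h.finite_neg h.weak hε hFm hF0 hFB hK' hK'U
    (fun p σ hp hσ => sub_mem_of_ne_zero hFs hp hσ) hAF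
  have hdi := h.integrable_difference hε ha hb hK hKU hFm (habs hF0 hFB) hFs
  have hsum := (hGi.const_mul (C * ε)).add hdi
  have heq : (fun p => f p * (C * ε * (1 - θ p) + θ p * (d p - d (p - (0, ε))))) =
      fun p => C * ε * G p + F p * (d p - d (p - (0, ε))) := by
    funext p
    simp only [F, G]
    ring
  rw [heq]
  refine ⟨hsum, ?_⟩
  rw [← hpair, integral_add (hGi.const_mul (C * ε)) hdi, integral_const_mul, hp1, hn1]
  linarith

end Local

/-! ### Passing to the limit in the pairing with the fields. -/

section FieldLimit

variable {r : ℝ} {C : ℝ≥0} {U K : Set (Space N)} {a b t₁ t₂ ε B : ℝ} {d : Space N × ℝ → ℝ}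
  {z : Space N × ℝ → Measure (Space N × Space N)} {μpos μneg : Measure (Space N × ℝ)}
  {f : Space N × ℝ → ℝ}

/-- The pairing of the measure `ζ` with the differences of `φ` around `w`. -/
noncomputable def diffPairing (φ : Space N → ℝ) (w : Space N) (ζ : Measure (Space N × Space N)) :
    ℝ := ∫ q, (φ (w + q.1) - φ (w + q.2)) ∂ζ

/-- A measure on `C_r` sees only points within `r` of `w`; the bound is an integrable majorant for
dominated convergence. -/
theorem AttainsOsc.abs_diffPairing_le {v : Space N → ℝ} {w : Space N}
    {ζ : Measure (Space N × Space N)} (h : AttainsOsc r v w ζ) {φ : Space N → ℝ}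
    (hB : ∀ x, |φ x| ≤ B) (hφ : ∀ x, φ x ≠ 0 → x ∈ K) :
    |diffPairing φ w ζ| ≤ (Metric.cthickening r K).indicator (fun _ => 2 * B) w := by
  have : IsFiniteMeasure ζ := ⟨h.1.trans_lt ENNReal.one_lt_top⟩
  have hB0 : 0 ≤ B := (abs_nonneg _).trans (hB 0)
  by_cases hw : w ∈ Metric.cthickening r K
  · rw [indicator_of_mem hw]
    have h1 := norm_integral_le_of_norm_le_const (μ := ζ) (C := 2 * B)
      (f := fun q : Space N × Space N => φ (w + q.1) - φ (w + q.2))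
      (Eventually.of_forall fun q => by
        have := abs_sub (φ (w + q.1)) (φ (w + q.2))
        rw [Real.norm_eq_abs]
        linarith [hB (w + q.1), hB (w + q.2)])
    have hmr : ζ.real univ ≤ 1 := ENNReal.toReal_le_of_le_ofReal zero_le_one (by simpa using h.1)
    calc |diffPairing φ w ζ| ≤ 2 * B * ζ.real univ := h1
      _ ≤ 2 * B * 1 := mul_le_mul_of_nonneg_left hmr (by positivity)
      _ = 2 * B := mul_one _
  · rw [indicator_of_notMem hw]
    have hz : ∀ y ∈ Metric.closedBall (0 : Space N) r, φ (w + y) = 0 := by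
      intro y hy
      by_contra hne
      refine hw (Metric.mem_cthickening_of_dist_le w (w + y) r K (hφ _ hne) ?_)
      simpa [dist_eq_norm] using hy
    have hae : ∀ᵐ q ∂ζ, q ∈ Cr N r := h.2.1
    have h0 : diffPairing φ w ζ = 0 := by
      refine integral_eq_zero_of_ae ?_
      filter_upwards [hae] with q hq
      simp [hz _ hq.1, hz _ hq.2]
    simp [h0]

theorem tendsto_diffPairing {ζ : Measure (Space N × Space N)} (hζ : ζ univ ≤ 1)
    {φ : ℕ → Space N → ℝ} {φ' : Space N → ℝ} {w : Space N} (hc : ∀ n, Continuous (φ n))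
    (hB : ∀ n x, |φ n x| ≤ B) (hlim : ∀ x, Tendsto (fun n => φ n x) atTop (𝓝 (φ' x))) :
    Tendsto (fun n => diffPairing (φ n) w ζ) atTop (𝓝 (diffPairing φ' w ζ)) := by
  have : IsFiniteMeasure ζ := ⟨hζ.trans_lt ENNReal.one_lt_top⟩
  refine tendsto_integral_of_dominated_convergence (fun _ => 2 * B)
    (fun n => ?_) (integrable_const _) (fun n => Eventually.of_forall fun q => ?_)
    (Eventually.of_forall fun q => (hlim _).sub (hlim _))
  · have := hc n
    exact Continuous.aestronglyMeasurable (by fun_prop)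
  · have := abs_sub (φ n (w + q.1)) (φ n (w + q.2))
    rw [Real.norm_eq_abs]
    linarith [hB n (w + q.1), hB n (w + q.2)]

theorem IsLocalSupersolution.aemeasurable_diffPairing
    (h : IsLocalSupersolution r C U a b d z μpos μneg) {φ : Space N × ℝ → ℝ} (hφ : Continuous φ)
    (hB : ∀ p, |φ p| ≤ B) :
    AEMeasurable (fun p => diffPairing (fun x => φ (x, p.2)) p.1 (z p))
      (volume.restrict (univ ×ˢ Ioo a b)) := by
  refine aemeasurable_integral_of_continuous (B := 2 * B)
    (f := fun p q => φ (p.1 + q.1, p.2) - φ (p.1 + q.2, p.2)) h.field_measurable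
    (h.field.mono fun p hp => hp.1) (fun p q => ?_) (fun q => by fun_prop) (fun p => by fun_prop)
  have := abs_sub (φ (p.1 + q.1, p.2)) (φ (p.1 + q.2, p.2))
  linarith [hB (p.1 + q.1, p.2), hB (p.1 + q.2, p.2)]

/-- The two fields share one integral in the limit because only the sum of the two pairings has a
sign. -/
theorem IsLocalSupersolution.tendsto_integral_diffPairing {d₁ d₂ : Space N × ℝ → ℝ}
    {z₁ z₂ : Space N × ℝ → Measure (Space N × Space N)}
    {μpos₁ μneg₁ μpos₂ μneg₂ : Measure (Space N × ℝ)}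
    (h₁ : IsLocalSupersolution r C U a b d₁ z₁ μpos₁ μneg₁)
    (h₂ : IsLocalSupersolution r C U a b d₂ z₂ μpos₂ μneg₂) (hK : IsCompact K)
    {φ : ℕ → Space N × ℝ → ℝ} (hc : ∀ n, Continuous (φ n)) (hB : ∀ n p, |φ n p| ≤ B)
    (hφ : ∀ n p, φ n p ≠ 0 → p.1 ∈ K)
    (hlim : ∀ᵐ s : ℝ, ∀ x, Tendsto (fun n => φ n (x, s)) atTop (𝓝 (f (x, s)))) :
    Tendsto (fun n =>
      (∫ p in univ ×ˢ Ioo a b, diffPairing (fun x => φ n (x, p.2)) p.1 (z₁ p)) +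
        ∫ p in univ ×ˢ Ioo a b, diffPairing (fun x => φ n (x, p.2)) p.1 (z₂ p)) atTop
      (𝓝 (∫ p in univ ×ˢ Ioo a b, (diffPairing (fun x => f (x, p.2)) p.1 (z₁ p) +
        diffPairing (fun x => f (x, p.2)) p.1 (z₂ p)))) := by
  set ν := (volume : Measure (Space N × ℝ)).restrict (univ ×ˢ Ioo a b) with hν
  set D : Set (Space N) := Metric.cthickening r K with hD
  have hDc : IsCompact D := hK.cthickening
  have hDm : MeasurableSet (D ×ˢ (univ : Set ℝ)) := hDc.isClosed.measurableSet.prod .univ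
  have hDν : ν (D ×ˢ univ) ≠ ⊤ := by
    rw [hν, Measure.restrict_apply hDm]
    refine ((measure_mono ?_).trans_lt
      (hDc.prod (isCompact_Icc (a := a) (b := b))).measure_lt_top).ne
    rintro p ⟨hp1, hp2⟩
    exact ⟨hp1.1, Ioo_subset_Icc_self hp2.2⟩
  have hgi : Integrable ((D ×ˢ (univ : Set ℝ)).indicator fun _ => 2 * B) ν :=
    (integrable_indicator_iff hDm).2 (integrableOn_const hDν)
  have hbound : ∀ {d z μpos μneg}, IsLocalSupersolution r C U a b d z μpos μneg → ∀ n,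
      ∀ᵐ p ∂ν, ‖diffPairing (fun x => φ n (x, p.2)) p.1 (z p)‖ ≤
        (D ×ˢ (univ : Set ℝ)).indicator (fun _ => 2 * B) p := by
    intro d z μpos μneg h n
    filter_upwards [h.field] with p hp
    refine (hp.abs_diffPairing_le (K := K) (fun x => hB n _) fun x hx => hφ n _ hx).trans_eq ?_
    by_cases hpD : p.1 ∈ D
    · rw [indicator_of_mem hpD, indicator_of_mem (by exact ⟨hpD, mem_univ _⟩)]
    · rw [indicator_of_notMem hpD, indicator_of_notMem (fun hmem => hpD hmem.1)]
  have hint : ∀ {d z μpos μneg}, IsLocalSupersolution r C U a b d z μpos μneg → ∀ n,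
      Integrable (fun p => diffPairing (fun x => φ n (x, p.2)) p.1 (z p)) ν := fun h n =>
    hgi.mono' (h.aemeasurable_diffPairing (hc n) (hB n)).aestronglyMeasurable (hbound h n)
  have hlim' : ∀ᵐ p ∂ν, ∀ x, Tendsto (fun n => φ n (x, p.2)) atTop (𝓝 (f (x, p.2))) :=
    ae_restrict_of_ae (Measure.quasiMeasurePreserving_snd.ae hlim)
  have hconv : ∀ {d z μpos μneg}, IsLocalSupersolution r C U a b d z μpos μneg → ∀ᵐ p ∂ν,
      Tendsto (fun n => diffPairing (fun x => φ n (x, p.2)) p.1 (z p)) atTop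
        (𝓝 (diffPairing (fun x => f (x, p.2)) p.1 (z p))) := by
    intro d z μpos μneg h
    filter_upwards [h.field, hlim'] with p hp hl
    exact tendsto_diffPairing hp.1 (fun n => (hc n).comp (by fun_prop)) (fun n x => hB n _) hl
  have heq : ∀ n, (∫ p, diffPairing (fun x => φ n (x, p.2)) p.1 (z₁ p) ∂ν) +
      (∫ p, diffPairing (fun x => φ n (x, p.2)) p.1 (z₂ p) ∂ν) =
      ∫ p, (diffPairing (fun x => φ n (x, p.2)) p.1 (z₁ p) +
        diffPairing (fun x => φ n (x, p.2)) p.1 (z₂ p)) ∂ν := fun n =>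
    (integral_add (hint h₁ n) (hint h₂ n)).symm
  simp only [heq]
  refine tendsto_integral_of_dominated_convergence
    (fun p => (D ×ˢ (univ : Set ℝ)).indicator (fun _ => 2 * B) p +
      (D ×ˢ (univ : Set ℝ)).indicator (fun _ => 2 * B) p)
    (fun n => ((hint h₁ n).add (hint h₂ n)).aestronglyMeasurable) (hgi.add hgi) (fun n => ?_) ?_
  · filter_upwards [hbound h₁ n, hbound h₂ n] with p hp1 hp2
    exact (norm_add_le _ _).trans (add_le_add hp1 hp2)
  · filter_upwards [hconv h₁, hconv h₂] with p hp1 hp2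
    exact hp1.add hp2

end FieldLimit

/-! ### Penalty and truncated distances. -/

section Energy

variable {r : ℝ} {C : ℝ≥0} {U K : Set (Space N)} {a b t₁ t₂ κ η Δ : ℝ}
  {d d₁ d₂ : Space N × ℝ → ℝ} {z₁ z₂ : Space N × ℝ → Measure (Space N × Space N)}
  {μpos₁ μneg₁ μpos₂ μneg₂ : Measure (Space N × ℝ)}

/-- The quadratic penalty of the values of `v` below `Δ`. -/
noncomputable def penalty (Δ v : ℝ) : ℝ := max (Δ - v) 0 ^ 2 / 2

/-- This is the tangent inequality for the convex function `penalty Δ`, whose slope at `v` is `-max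
(Δ - v) 0`. It stands in for the chain rule across jumps. -/
theorem mul_sub_le_penalty (Δ v w : ℝ) : max (Δ - v) 0 * (v - w) ≤ penalty Δ w - penalty Δ v := by
  unfold penalty
  rcases le_total (Δ - v) 0 with h | h
  · rw [max_eq_right h]
    nlinarith [sq_nonneg (max (Δ - w) 0)]
  · rw [max_eq_left h]
    rcases le_total (Δ - w) 0 with h' | h'
    · rw [max_eq_right h']
      nlinarith [sq_nonneg (Δ - v)]
    · rw [max_eq_left h']
      nlinarith [sq_nonneg (v - w)]

theorem penalty_nonneg (Δ v : ℝ) : 0 ≤ penalty Δ v := by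
  unfold penalty
  positivity

theorem penalty_le {v m : ℝ} (hm : 0 ≤ m) (h : Δ - v ≤ m) : penalty Δ v ≤ m ^ 2 / 2 := by
  unfold penalty
  have h0 := le_max_right (Δ - v) 0
  have h1 := max_le h hm
  nlinarith

theorem continuous_penalty (Δ : ℝ) : Continuous (penalty Δ) := by
  unfold penalty
  fun_prop

theorem lt_of_penalty_ne_zero {v : ℝ} (h : penalty Δ v ≠ 0) : v < Δ := by
  by_contra hcon
  refine h ?_
  unfold penalty
  rw [max_eq_right (by linarith)]
  simp

/-- The distance function `d`, smoothly truncated from below at the level `η + C (t - a)`. -/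
noncomputable def truncated (κ η C a : ℝ) (d : Space N × ℝ → ℝ) (p : Space N × ℝ) : ℝ :=
  η + C * (p.2 - a) + softPos κ (d p - (η + C * (p.2 - a)))

theorem le_truncated (κ η C a : ℝ) (d : Space N × ℝ → ℝ) (p : Space N × ℝ) :
    d p ≤ truncated κ η C a d p := by
  have := le_softPos κ (d p - (η + C * (p.2 - a)))
  unfold truncated
  linarith

theorem level_le_truncated (κ η C a : ℝ) (d : Space N × ℝ → ℝ) (p : Space N × ℝ) :
    η + C * (p.2 - a) ≤ truncated κ η C a d p := by
  have := softPos_nonneg κ (d p - (η + C * (p.2 - a)))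
  unfold truncated
  linarith

theorem truncated_le (hκ : 0 < κ) (η C a : ℝ) (d : Space N × ℝ → ℝ) (p : Space N × ℝ) :
    truncated κ η C a d p ≤ max (d p) (η + C * (p.2 - a)) + κ := by
  have h := softPos_le hκ (d p - (η + C * (p.2 - a)))
  have h1 : max (d p - (η + C * (p.2 - a))) 0 =
      max (d p) (η + C * (p.2 - a)) - (η + C * (p.2 - a)) := by
    rw [← max_sub_sub_right, sub_self]
  unfold truncated
  linarith

theorem measurable_truncated (hd : Measurable d) (κ η C a : ℝ) :
    Measurable (truncated κ η C a d) := by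
  have := (continuous_softPos κ).measurable
  unfold truncated
  fun_prop

theorem continuous_truncated (κ η C a s : ℝ) (hd : Continuous fun x => d (x, s)) :
    Continuous fun x => truncated κ η C a d (x, s) := by
  have h : Continuous fun x => softPos κ (d (x, s) - (η + C * (s - a))) :=
    (continuous_softPos κ).comp (hd.sub continuous_const)
  have h0 : Continuous fun _ : Space N => η + C * (s - a) := continuous_const
  exact h0.add h

theorem abs_truncated_sub_le (hκ : 0 < κ) (η C a s : ℝ) (hd : LipschitzWith 1 fun x => d (x, s))
    (x y : Space N) :
    |truncated κ η C a d (x, s) - truncated κ η C a d (y, s)| ≤ dist x y := by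
  have h1 := abs_softPos_sub_le hκ (d (x, s) - (η + C * (s - a))) (d (y, s) - (η + C * (s - a)))
  have h2 := hd.dist_le_mul x y
  simp only [NNReal.coe_one, one_mul, Real.dist_eq] at h2
  rw [sub_sub_sub_cancel_right] at h1
  unfold truncated
  simp only
  rw [add_sub_add_left_eq_sub]
  exact h1.trans h2

theorem tendsto_truncated (κ η C a : ℝ) {s : ℝ} {x : Space N}
    (hd : Tendsto (fun s => d (x, s)) (𝓝[<] s) (𝓝 (d (x, s)))) :
    Tendsto (fun s => truncated κ η C a d (x, s)) (𝓝[<] s) (𝓝 (truncated κ η C a d (x, s))) := by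
  have h1 : Tendsto (fun s : ℝ => η + C * (s - a)) (𝓝[<] s) (𝓝 (η + C * (s - a))) :=
    ((by fun_prop : Continuous fun s : ℝ => η + C * (s - a)).tendsto s).mono_left
      nhdsWithin_le_nhds
  exact h1.add (((continuous_softPos κ).tendsto _).comp (hd.sub h1))

/-- Convexity of `softPos`, with the tangent taken at the earlier time. The level rises by `C ε`,
which produces the term `C ε (1 - θ)` of the mixed weight. -/
theorem weighted_le_truncated_sub (hκ : 0 < κ) (η C a ε : ℝ) (p : Space N × ℝ) :
    C * ε * (1 - softStep κ (d (p - (0, ε)) - (η + C * (p.2 - ε - a)))) +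
      softStep κ (d (p - (0, ε)) - (η + C * (p.2 - ε - a))) * (d p - d (p - (0, ε))) ≤
    truncated κ η C a d p - truncated κ η C a d (p - (0, ε)) := by
  have h := softStep_mul_le hκ (d (p - (0, ε)) - (η + C * (p.2 - ε - a)))
    (d p - (η + C * (p.2 - a)))
  unfold truncated
  simp only [Prod.snd_sub]
  linarith

end Energy

/-! ### Decay of the energy. -/

section EnergyDecay

variable {r : ℝ} {C : ℝ≥0} {U K : Set (Space N)} {a b t₁ t₂ κ η Δ : ℝ}
  {d₁ d₂ : Space N × ℝ → ℝ} {z₁ z₂ : Space N × ℝ → Measure (Space N × Space N)}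
  {μpos₁ μneg₁ μpos₂ μneg₂ : Measure (Space N × ℝ)}

/-- The sum of the truncated distance functions. -/
noncomputable def truncatedSum (κ η C a : ℝ) (d₁ d₂ : Space N × ℝ → ℝ) (p : Space N × ℝ) : ℝ :=
  truncated κ η C a d₁ p + truncated κ η C a d₂ p

/-- The energy of the truncated distance functions at time `t`. -/
noncomputable def energy (Δ κ η C a : ℝ) (d₁ d₂ : Space N × ℝ → ℝ) (t : ℝ) : ℝ :=
  ∫ x, penalty Δ (truncatedSum κ η C a d₁ d₂ (x, t))

theorem energy_nonneg (Δ κ η C a : ℝ) (d₁ d₂ : Space N × ℝ → ℝ) (t : ℝ) :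
    0 ≤ energy Δ κ η C a d₁ d₂ t := integral_nonneg fun _ => penalty_nonneg _ _

theorem diffPairing_div (φ : Space N → ℝ) (w : Space N) (ζ : Measure (Space N × Space N)) (c : ℝ) :
    diffPairing (fun x => φ x / c) w ζ = diffPairing φ w ζ / c := by
  simp only [diffPairing]
  rw [← integral_div]
  simp only [sub_div]

/-- The averages are backward in time, so left continuity suffices, and nothing more is known of the
energy. -/
theorem tendsto_integral_div_of_tendsto_left {y : ℝ → ℝ} {t : ℝ} {ε : ℕ → ℝ}
    (hy : Tendsto y (𝓝[<] t) (𝓝 (y t))) (hε : ∀ n, 0 < ε n) (hlim : Tendsto ε atTop (𝓝 0))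
    (hi : ∀ n, IntervalIntegrable y volume (t - ε n) t) :
    Tendsto (fun n => (∫ s in (t - ε n)..t, y s) / ε n) atTop (𝓝 (y t)) := by
  rw [Metric.tendsto_atTop]
  intro e he
  have hev : ∀ᶠ s in 𝓝[<] t, dist (y s) (y t) < e / 2 :=
    hy (Metric.ball_mem_nhds _ (by positivity))
  obtain ⟨l, hl, hlt⟩ := (mem_nhdsLT_iff_exists_Ioo_subset).1 hev
  obtain ⟨n₀, hn₀⟩ := Metric.tendsto_atTop.1 hlim (t - l) (sub_pos.2 hl)
  refine ⟨n₀, fun n hn => ?_⟩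
  have h1 := hn₀ n hn
  rw [Real.dist_eq, sub_zero, abs_of_pos (hε n)] at h1
  have h2 : (∫ s in (t - ε n)..t, y s) / ε n - y t = (∫ s in (t - ε n)..t, (y s - y t)) / ε n := by
    rw [intervalIntegral.integral_sub (hi n) (by simp), intervalIntegral.integral_const, sub_div]
    congr 1
    have := (hε n).ne'
    simp only [smul_eq_mul, sub_sub_cancel]
    field_simp
  have h3 := intervalIntegral.norm_integral_le_of_norm_le_const (a := t - ε n) (b := t)
    (C := e / 2) (f := fun s => y s - y t) (fun s hs => by
      rw [uIoc_of_le (by linarith [hε n])] at hs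
      rcases eq_or_lt_of_le hs.2 with h | h
      · rw [h, sub_self, norm_zero]
        positivity
      · have : s ∈ Ioo l t := ⟨by linarith [hs.1], h⟩
        exact (hlt this).le)
  rw [Real.dist_eq, h2, abs_div, abs_of_pos (hε n), div_lt_iff₀ (hε n)]
  rw [sub_sub_cancel, abs_of_pos (hε n), Real.norm_eq_abs] at h3
  have := mul_pos (half_pos he) (hε n)
  linarith

theorem measurable_truncatedSum (h₁ : Measurable d₁) (h₂ : Measurable d₂) (κ η C a : ℝ) :
    Measurable (truncatedSum κ η C a d₁ d₂) :=
  (measurable_truncated h₁ _ _ _ _).add (measurable_truncated h₂ _ _ _ _)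

theorem energy_measurable (h₁ : Measurable d₁) (h₂ : Measurable d₂) (Δ κ η C a : ℝ) :
    Measurable (energy Δ κ η C a d₁ d₂) := by
  have hm : Measurable fun p => penalty Δ (truncatedSum κ η C a d₁ d₂ p) :=
    (continuous_penalty Δ).measurable.comp (measurable_truncatedSum h₁ h₂ κ η C a)
  exact (hm.stronglyMeasurable.integral_prod_left' (μ := (volume : Measure (Space N)))).measurable

theorem penalty_truncatedSum_le (hΔ : 0 ≤ Δ) (h₁ : ∀ p, 0 ≤ d₁ p) (h₂ : ∀ p, 0 ≤ d₂ p)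
    (κ η C a : ℝ) (p : Space N × ℝ) :
    |penalty Δ (truncatedSum κ η C a d₁ d₂ p)| ≤ Δ ^ 2 / 2 := by
  rw [abs_of_nonneg (penalty_nonneg _ _)]
  refine penalty_le hΔ ?_
  have e1 := le_truncated κ η C a d₁ p
  have e2 := le_truncated κ η C a d₂ p
  unfold truncatedSum
  linarith [h₁ p, h₂ p]

theorem energy_tendsto_left (h₁ : IsLocalSupersolution r C U a b d₁ z₁ μpos₁ μneg₁)
    (h₂ : IsLocalSupersolution r C U a b d₂ z₂ μpos₂ μneg₂) (hΔ : 0 ≤ Δ) (hK : IsCompact K)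
    (huK : ∀ x, ∀ s ∈ Ioo a b, truncatedSum κ η C a d₁ d₂ (x, s) < Δ → x ∈ K) {t : ℝ}
    (ht : t ∈ Ioo a b) :
    Tendsto (energy Δ κ η C a d₁ d₂) (𝓝[<] t) (𝓝 (energy Δ κ η C a d₁ d₂ t)) := by
  have hm : Measurable fun p => penalty Δ (truncatedSum κ η C a d₁ d₂ p) :=
    (continuous_penalty Δ).measurable.comp
      (measurable_truncatedSum h₁.measurable h₂.measurable κ η C a)
  refine tendsto_integral_filter_of_dominated_convergence (K.indicator fun _ => Δ ^ 2 / 2)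
    (Eventually.of_forall fun s => (hm.comp measurable_prodMk_right).aestronglyMeasurable)
    ?_ ((integrable_indicator_iff hK.isClosed.measurableSet).2
      (integrableOn_const hK.measure_lt_top.ne)) ?_
  · filter_upwards [Ioo_mem_nhdsLT ht.1] with s hs
    refine Eventually.of_forall fun x => ?_
    by_cases hx : x ∈ K
    · rw [indicator_of_mem hx]
      exact penalty_truncatedSum_le hΔ h₁.nonneg h₂.nonneg _ _ _ _ _
    · have : penalty Δ (truncatedSum κ η C a d₁ d₂ (x, s)) = 0 := by
        by_contra hne
        exact hx (huK x s ⟨hs.1, hs.2.trans ht.2⟩ (lt_of_penalty_ne_zero hne))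
      rw [this, indicator_of_notMem hx, norm_zero]
  · refine Eventually.of_forall fun x => ((continuous_penalty Δ).tendsto _).comp ?_
    exact (tendsto_truncated _ _ _ _ (h₁.left t ht x)).add
      (tendsto_truncated _ _ _ _ (h₂.left t ht x))

theorem energy_le_mul (hK : IsCompact K) {t c : ℝ}
    (hc : ∀ x, penalty Δ (truncatedSum κ η C a d₁ d₂ (x, t)) ≤ c)
    (huK : ∀ x, truncatedSum κ η C a d₁ d₂ (x, t) < Δ → x ∈ K) :
    energy Δ κ η C a d₁ d₂ t ≤ volume.real K * c := by
  have hle : energy Δ κ η C a d₁ d₂ t ≤ ∫ x, K.indicator (fun _ => c) x := by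
    refine integral_mono_of_nonneg (Eventually.of_forall fun x => penalty_nonneg _ _)
      ((integrable_indicator_iff hK.isClosed.measurableSet).2
        (integrableOn_const hK.measure_lt_top.ne)) (Eventually.of_forall fun x => ?_)
    beta_reduce
    by_cases hx : x ∈ K
    · rw [indicator_of_mem hx]
      exact hc x
    · have : penalty Δ (truncatedSum κ η C a d₁ d₂ (x, t)) = 0 := by
        by_contra hne
        exact hx (huK x (lt_of_penalty_ne_zero hne))
      rw [this, indicator_of_notMem hx]
  refine hle.trans_eq ?_
  rw [integral_indicator hK.isClosed.measurableSet, setIntegral_const, smul_eq_mul]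

theorem energy_intervalIntegrable (h₁ : IsLocalSupersolution r C U a b d₁ z₁ μpos₁ μneg₁)
    (h₂ : IsLocalSupersolution r C U a b d₂ z₂ μpos₂ μneg₂) (hΔ : 0 ≤ Δ) (hK : IsCompact K)
    (huK : ∀ x, ∀ s ∈ Ioo a b, truncatedSum κ η C a d₁ d₂ (x, s) < Δ → x ∈ K) {s t : ℝ}
    (hs : s ∈ Ioo a b) (ht : t ∈ Ioo a b) :
    IntervalIntegrable (energy Δ κ η C a d₁ d₂) volume s t := by
  rw [intervalIntegrable_iff]
  refine IntegrableOn.of_bound (by simp [uIoc])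
    (energy_measurable h₁.measurable h₂.measurable _ _ _ _ _).aestronglyMeasurable
    (volume.real K * (Δ ^ 2 / 2)) ?_
  filter_upwards [ae_restrict_mem measurableSet_uIoc] with τ hτ
  have hτ' : τ ∈ Ioo a b := by
    have := uIoc_subset_uIcc hτ
    rw [mem_uIcc] at this
    rcases this with h | h
    · exact ⟨hs.1.trans_le h.1, h.2.trans_lt ht.2⟩
    · exact ⟨ht.1.trans_le h.1, h.2.trans_lt hs.2⟩
  rw [Real.norm_eq_abs, abs_of_nonneg (energy_nonneg _ _ _ _ _ _ _ _)]
  exact energy_le_mul hK (fun x => (le_abs_self _).trans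
    (penalty_truncatedSum_le hΔ h₁.nonneg h₂.nonneg _ _ _ _ _)) fun x => huK x τ hτ'

/-- By Fubini the integral is that of `e(t - ε) - e(t)` over `(t₁, t₂]` for the energy `e`, which
telescopes to two windows of length `ε`. -/
theorem energy_sub_integral (h₁ : IsLocalSupersolution r C U a b d₁ z₁ μpos₁ μneg₁)
    (h₂ : IsLocalSupersolution r C U a b d₂ z₂ μpos₂ μneg₂) (hΔ : 0 ≤ Δ) (hK : IsCompact K)
    (huK : ∀ x, ∀ s ∈ Ioo a b, truncatedSum κ η C a d₁ d₂ (x, s) < Δ → x ∈ K) {ε : ℝ} (hε : 0 < ε)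
    (ha : a < t₁ - ε) (h12 : t₁ ≤ t₂) (hb : t₂ < b) :
    Integrable ({p : Space N × ℝ | p.2 ∈ Ioc t₁ t₂}.indicator fun p =>
      penalty Δ (truncatedSum κ η C a d₁ d₂ (p - (0, ε))) -
        penalty Δ (truncatedSum κ η C a d₁ d₂ p)) ∧
    ∫ p, {p : Space N × ℝ | p.2 ∈ Ioc t₁ t₂}.indicator (fun p =>
      penalty Δ (truncatedSum κ η C a d₁ d₂ (p - (0, ε))) -
        penalty Δ (truncatedSum κ η C a d₁ d₂ p)) p =
      (∫ t in (t₁ - ε)..t₁, energy Δ κ η C a d₁ d₂ t) -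
        ∫ t in (t₂ - ε)..t₂, energy Δ κ η C a d₁ d₂ t := by
  set P : Space N × ℝ → ℝ := fun p => penalty Δ (truncatedSum κ η C a d₁ d₂ p) with hP
  have hm : Measurable P := (continuous_penalty Δ).measurable.comp
    (measurable_truncatedSum h₁.measurable h₂.measurable κ η C a)
  have hPB : ∀ p, |P p| ≤ Δ ^ 2 / 2 :=
    penalty_truncatedSum_le hΔ h₁.nonneg h₂.nonneg _ _ _ _
  have hPK : ∀ x, ∀ s ∈ Ioo a b, P (x, s) ≠ 0 → x ∈ K := fun x s hs hne =>
    huK x s hs (lt_of_penalty_ne_zero hne)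
  have hIoc : MeasurableSet {p : Space N × ℝ | p.2 ∈ Ioc t₁ t₂} := measurable_snd measurableSet_Ioc
  have hshift : ∀ (x : Space N) (t : ℝ), ((x, t) : Space N × ℝ) - (0, ε) = (x, t - ε) := by
    intro x t
    simp
  have hint : Integrable ({p : Space N × ℝ | p.2 ∈ Ioc t₁ t₂}.indicator fun p =>
      P (p - (0, ε)) - P p) := by
    refine integrable_of_bdd_support (B := Δ ^ 2) (s := K ×ˢ Icc t₁ t₂)
      (((hm.comp (by fun_prop)).sub hm).indicator hIoc).aestronglyMeasurable
      (hK.prod isCompact_Icc).measure_lt_top (fun p => ?_) ?_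
    · by_cases hp : p.2 ∈ Ioc t₁ t₂
      · rw [indicator_of_mem (by exact hp)]
        have := abs_sub (P (p - (0, ε))) (P p)
        linarith [hPB p, hPB (p - (0, ε))]
      · rw [indicator_of_notMem (by exact hp), abs_zero]
        positivity
    · rintro ⟨x, t⟩ hp
      have ht : t ∈ Ioc t₁ t₂ := by
        by_contra hcon
        exact hp (indicator_of_notMem (by exact hcon) _)
      rw [indicator_of_mem (by exact ht), hshift] at hp
      refine ⟨?_, Ioc_subset_Icc_self ht⟩
      by_contra hx
      have e1 : P (x, t) = 0 := by
        by_contra hne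
        exact hx (hPK x t ⟨by linarith [ht.1], ht.2.trans_lt hb⟩ hne)
      have e2 : P (x, t - ε) = 0 := by
        by_contra hne
        exact hx (hPK x _ ⟨by linarith [ht.1], by linarith [ht.2]⟩ hne)
      exact hp (by rw [e1, e2, sub_zero])
  have hPi : ∀ t ∈ Ioo a b, Integrable fun x => P (x, t) := fun t ht =>
    integrable_of_bdd_support (hm.comp measurable_prodMk_right).aestronglyMeasurable
      hK.measure_lt_top (fun x => hPB _) fun x hx => hPK x t ht hx
  refine ⟨hint, ?_⟩
  have hfub := integral_prod_symm (μ := (volume : Measure (Space N))) (ν := (volume : Measure ℝ))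
    _ hint
  refine hfub.trans ?_
  have hsec : ∀ t, (∫ x : Space N, {p : Space N × ℝ | p.2 ∈ Ioc t₁ t₂}.indicator (fun p =>
      P (p - (0, ε)) - P p) (x, t)) = (Ioc t₁ t₂).indicator (fun t =>
        energy Δ κ η C a d₁ d₂ (t - ε) - energy Δ κ η C a d₁ d₂ t) t := by
    intro t
    by_cases ht : t ∈ Ioc t₁ t₂
    · rw [indicator_of_mem ht]
      have : ∀ x : Space N, {p : Space N × ℝ | p.2 ∈ Ioc t₁ t₂}.indicator (fun p =>
          P (p - (0, ε)) - P p) (x, t) = P (x, t - ε) - P (x, t) := fun x => by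
        rw [indicator_of_mem (by exact ht), hshift]
      simp only [this]
      exact integral_sub (hPi _ ⟨by linarith [ht.1], by linarith [ht.2]⟩)
        (hPi _ ⟨by linarith [ht.1], ht.2.trans_lt hb⟩)
    · rw [indicator_of_notMem ht]
      have : ∀ x : Space N, {p : Space N × ℝ | p.2 ∈ Ioc t₁ t₂}.indicator (fun p =>
          P (p - (0, ε)) - P p) (x, t) = 0 := fun x => indicator_of_notMem (by exact ht) _
      simp only [this, integral_zero]
  simp only [hsec]
  rw [integral_indicator measurableSet_Ioc, ← intervalIntegral.integral_of_le h12]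
  have hii : ∀ s t, s ∈ Ioo a b → t ∈ Ioo a b →
      IntervalIntegrable (energy Δ κ η C a d₁ d₂) volume s t := fun s t hs ht =>
    energy_intervalIntegrable h₁ h₂ hΔ hK huK hs ht
  have m1 : t₁ ∈ Ioo a b := ⟨by linarith, by linarith⟩
  have m2 : t₂ ∈ Ioo a b := ⟨by linarith, by linarith⟩
  have m3 : t₁ - ε ∈ Ioo a b := ⟨by linarith, by linarith⟩
  have m4 : t₂ - ε ∈ Ioo a b := ⟨by linarith, by linarith⟩
  have hi1 : IntervalIntegrable (fun t => energy Δ κ η C a d₁ d₂ (t - ε)) volume t₁ t₂ := by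
    have := (hii _ _ m3 m4).comp_sub_right ε
    simpa using this
  rw [intervalIntegral.integral_sub hi1 (hii _ _ m1 m2),
    intervalIntegral.integral_comp_sub_right (fun t => energy Δ κ η C a d₁ d₂ t)]
  rw [intervalIntegral.integral_interval_sub_interval_comm (hii _ _ m3 m4) (hii _ _ m1 m2)
    (hii _ _ m3 m1)]

/-- The test function of the comparison argument. -/
noncomputable def testFunction (Δ κ η C a t₁ t₂ : ℝ) (d₁ d₂ : Space N × ℝ → ℝ) :
    Space N × ℝ → ℝ :=
  {p : Space N × ℝ | p.2 ∈ Ioc t₁ t₂}.indicator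
    fun p => max (Δ - truncatedSum κ η C a d₁ d₂ p) 0

theorem testFunction_of_mem {p : Space N × ℝ} (hp : p.2 ∈ Ioc t₁ t₂) :
    testFunction Δ κ η C a t₁ t₂ d₁ d₂ p = max (Δ - truncatedSum κ η C a d₁ d₂ p) 0 :=
  indicator_of_mem (by exact hp) _

theorem testFunction_of_notMem {p : Space N × ℝ} (hp : p.2 ∉ Ioc t₁ t₂) :
    testFunction Δ κ η C a t₁ t₂ d₁ d₂ p = 0 :=
  indicator_of_notMem (by exact hp) _

theorem measurable_testFunction (h₁ : Measurable d₁) (h₂ : Measurable d₂) :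
    Measurable (testFunction Δ κ η C a t₁ t₂ d₁ d₂) :=
  ((measurable_const.sub (measurable_truncatedSum h₁ h₂ κ η C a)).max measurable_const).indicator
    (measurable_snd measurableSet_Ioc)

theorem testFunction_nonneg (p : Space N × ℝ) : 0 ≤ testFunction Δ κ η C a t₁ t₂ d₁ d₂ p :=
  indicator_nonneg (fun _ _ => le_max_right _ _) _

theorem testFunction_le (hΔ : 0 ≤ Δ) (h₁ : ∀ p, 0 ≤ d₁ p) (h₂ : ∀ p, 0 ≤ d₂ p)
    (p : Space N × ℝ) : testFunction Δ κ η C a t₁ t₂ d₁ d₂ p ≤ Δ := by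
  refine indicator_apply_le' (fun _ => max_le ?_ hΔ) fun _ => hΔ
  have e1 := le_truncated κ η C a d₁ p
  have e2 := le_truncated κ η C a d₂ p
  unfold truncatedSum
  linarith [h₁ p, h₂ p]

theorem mem_of_testFunction_ne_zero (ha : a ≤ t₁) (hb : t₂ < b)
    (huK : ∀ x, ∀ s ∈ Ioo a b, truncatedSum κ η C a d₁ d₂ (x, s) < Δ → x ∈ K) {p : Space N × ℝ}
    (hp : testFunction Δ κ η C a t₁ t₂ d₁ d₂ p ≠ 0) : p ∈ K ×ˢ Ioc t₁ t₂ := by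
  have ht : p.2 ∈ Ioc t₁ t₂ := by
    by_contra hcon
    exact hp (testFunction_of_notMem hcon)
  rw [testFunction_of_mem ht] at hp
  refine ⟨huK _ p.2 ⟨ha.trans_lt ht.1, ht.2.trans_lt hb⟩ ?_, ht⟩
  by_contra hcon
  refine hp (max_eq_right ?_)
  simp only [Prod.mk.eta] at hcon
  linarith

theorem lipschitz_testFunction (hκ : 0 < κ) (h₁ : ∀ s, LipschitzWith 1 fun x => d₁ (x, s))
    (h₂ : ∀ s, LipschitzWith 1 fun x => d₂ (x, s)) (t : ℝ) :
    LipschitzWith 2 fun x => testFunction Δ κ η C a t₁ t₂ d₁ d₂ (x, t) := by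
  refine LipschitzWith.of_dist_le_mul fun x y => ?_
  by_cases ht : t ∈ Ioc t₁ t₂
  · rw [testFunction_of_mem ht, testFunction_of_mem ht, Real.dist_eq]
    have e1 := abs_truncated_sub_le hκ η C a t (h₁ t) x y
    have e2 := abs_truncated_sub_le hκ η C a t (h₂ t) x y
    refine (abs_max_sub_max_le_abs _ _ _).trans ?_
    unfold truncatedSum
    rw [abs_le] at e1 e2 ⊢
    simp only [NNReal.coe_ofNat]
    constructor <;> linarith [e1.1, e1.2, e2.1, e2.2]
  · rw [testFunction_of_notMem ht, testFunction_of_notMem ht, dist_self]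
    positivity

theorem testFunction_integral_add_nonpos (hr : 0 < r) (hκ : 0 < κ) {p : Space N × ℝ}
    (hc₁ : Continuous fun x => d₁ (x, p.2)) (hc₂ : Continuous fun x => d₂ (x, p.2))
    (h₁ : AttainsOsc r (fun x => d₁ (x, p.2)) p.1 (z₁ p))
    (h₂ : AttainsOsc r (fun x => d₂ (x, p.2)) p.1 (z₂ p)) :
    diffPairing (fun x => testFunction Δ κ η C a t₁ t₂ d₁ d₂ (x, p.2)) p.1 (z₁ p) +
      diffPairing (fun x => testFunction Δ κ η C a t₁ t₂ d₁ d₂ (x, p.2)) p.1 (z₂ p) ≤ 0 := by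
  by_cases ht : p.2 ∈ Ioc t₁ t₂
  · have he : ∀ x : Space N, testFunction Δ κ η C a t₁ t₂ d₁ d₂ (x, p.2) =
        max (Δ - truncatedSum κ η C a d₁ d₂ (x, p.2)) 0 := fun x => testFunction_of_mem ht
    simp only [he]
    have hmono : ∀ c : ℝ, Monotone fun v => c + softPos κ (v - c) := fun c v w hvw => by
      have := softPos_mono hκ (sub_le_sub_right hvw c)
      simp only
      linarith
    refine h₁.integral_add_nonpos hr hc₁ hc₂ h₂ (γ := fun v w =>
      max (Δ - (η + C * (p.2 - a) + softPos κ (v - (η + C * (p.2 - a))) +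
        (η + C * (p.2 - a) + softPos κ (w - (η + C * (p.2 - a)))))) 0) ?_ ?_ ?_
    · intro w v v' hv
      have := hmono (η + C * (p.2 - a)) hv
      simp only at this ⊢
      exact max_le_max (by linarith) le_rfl
    · intro w v v' hv
      have := hmono (η + C * (p.2 - a)) hv
      simp only at this ⊢
      exact max_le_max (by linarith) le_rfl
    · have e1 := continuous_truncated κ η C a p.2 hc₁
      have e2 := continuous_truncated κ η C a p.2 hc₂
      exact (continuous_const.sub (e1.add e2)).max continuous_const
  · have he : ∀ x : Space N, testFunction Δ κ η C a t₁ t₂ d₁ d₂ (x, p.2) = 0 :=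
      fun x => testFunction_of_notMem ht
    simp [he, diffPairing]

/-- The energy inequality before division by `ε`: the weights `θ` are the slopes of the truncation
at time `t - ε`, so the weighted differences are dominated by those of the truncated distances, and
the convexity of `penalty` concludes. -/
theorem pairing_le_energy_sub (hκ : 0 < κ)
    (h₁ : IsLocalSupersolution r C U a b d₁ z₁ μpos₁ μneg₁)
    (h₂ : IsLocalSupersolution r C U a b d₂ z₂ μpos₂ μneg₂) (hΔ : 0 ≤ Δ) (hK : IsCompact K)
    (hKU : K ⊆ U)
    (huK : ∀ x, ∀ s ∈ Ioo a b, truncatedSum κ η C a d₁ d₂ (x, s) < Δ → x ∈ K) {ε : ℝ} (hε : 0 < ε)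
    (ha : a < t₁ - ε) (h12 : t₁ ≤ t₂) (hb : t₂ < b) :
    -(1 / (2 * r)) * ((∫ p in univ ×ˢ Ioo a b, diffPairing (fun x =>
        forwardIntegral ε (testFunction Δ κ η C a t₁ t₂ d₁ d₂) (x, p.2)) p.1 (z₁ p)) +
      ∫ p in univ ×ˢ Ioo a b, diffPairing (fun x =>
        forwardIntegral ε (testFunction Δ κ η C a t₁ t₂ d₁ d₂) (x, p.2)) p.1 (z₂ p)) ≤
      (∫ t in (t₁ - ε)..t₁, energy Δ κ η C a d₁ d₂ t) -
        ∫ t in (t₂ - ε)..t₂, energy Δ κ η C a d₁ d₂ t := by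
  set f := testFunction Δ κ η C a t₁ t₂ d₁ d₂ with hf
  let θ : (Space N × ℝ → ℝ) → Space N × ℝ → ℝ := fun d p =>
    softStep κ (d (p - (0, ε)) - (η + C * (p.2 - ε - a)))
  have hθm : ∀ d : Space N × ℝ → ℝ, Measurable d → Measurable (θ d) := fun d hd => by
    have := (continuous_softStep hκ).measurable
    refine this.comp ((hd.comp (by fun_prop)).sub (by fun_prop))
  have hθc : ∀ d : Space N × ℝ → ℝ, (∀ s, LipschitzWith 1 fun x => d (x, s)) → ∀ t,
      Continuous fun x => θ d (x, t) := fun d hd t => by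
    have e : Continuous fun x => d (x, t - ε) := (hd _).continuous
    have : (fun x => θ d (x, t)) = fun x =>
        softStep κ (d (x, t - ε) - (η + C * (t - ε - a))) := by
      funext x
      simp [θ]
    rw [this]
    exact (continuous_softStep hκ).comp (e.sub continuous_const)
  have hfm := measurable_testFunction (Δ := Δ) (κ := κ) (η := η) (C := C) (a := a) (t₁ := t₁)
    (t₂ := t₂) h₁.measurable h₂.measurable
  have hfB : ∀ p, f p ≤ Δ := testFunction_le hΔ h₁.nonneg h₂.nonneg
  have hfc : ∀ t, Continuous fun x => f (x, t) := fun t =>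
    (lipschitz_testFunction hκ h₁.lipschitz h₂.lipschitz t).continuous
  have hfs : ∀ p, f p ≠ 0 → p ∈ K ×ˢ Ioc t₁ t₂ := fun p hp =>
    mem_of_testFunction_ne_zero (by linarith) hb huK hp
  obtain ⟨hi₁, hle₁⟩ := h₁.pairing_forwardIntegral_le (θ := θ d₁) hε.le ha hb hK hKU hfm
    testFunction_nonneg hfB hfc hfs (hθm _ h₁.measurable) (fun p => softStep_nonneg hκ _)
    (fun p => softStep_le_one hκ _) (hθc _ h₁.lipschitz)
  obtain ⟨hi₂, hle₂⟩ := h₂.pairing_forwardIntegral_le (θ := θ d₂) hε.le ha hb hK hKU hfm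
    testFunction_nonneg hfB hfc hfs (hθm _ h₂.measurable) (fun p => softStep_nonneg hκ _)
    (fun p => softStep_le_one hκ _) (hθc _ h₂.lipschitz)
  obtain ⟨hiS, hS⟩ := energy_sub_integral h₁ h₂ hΔ hK huK hε ha h12 hb
  rw [← hS, mul_add]
  refine (add_le_add hle₁ hle₂).trans ?_
  rw [← integral_add hi₁ hi₂]
  refine integral_mono (hi₁.add hi₂) hiS fun p => ?_
  simp only
  by_cases hp : p.2 ∈ Ioc t₁ t₂
  · rw [indicator_of_mem (by exact hp), ← hf]
    have hfp : f p = max (Δ - truncatedSum κ η C a d₁ d₂ p) 0 := testFunction_of_mem hp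
    have e1 := weighted_le_truncated_sub (d := d₁) hκ η C a ε p
    have e2 := weighted_le_truncated_sub (d := d₂) hκ η C a ε p
    have e3 := mul_sub_le_penalty Δ (truncatedSum κ η C a d₁ d₂ p)
      (truncatedSum κ η C a d₁ d₂ (p - (0, ε)))
    rw [← hfp] at e3
    refine le_trans ?_ e3
    rw [← mul_add]
    refine mul_le_mul_of_nonneg_left ?_ (testFunction_nonneg p)
    unfold truncatedSum
    simp only [θ]
    linarith
  · rw [indicator_of_notMem (by exact hp)]
    have hfp : f p = 0 := testFunction_of_notMem hp
    rw [hf] at hfp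
    simp [hfp]

/-- The energy is nonincreasing in time. -/
theorem energy_antitone (hr : 0 < r) (hκ : 0 < κ)
    (h₁ : IsLocalSupersolution r C U a b d₁ z₁ μpos₁ μneg₁)
    (h₂ : IsLocalSupersolution r C U a b d₂ z₂ μpos₂ μneg₂) (hΔ : 0 ≤ Δ) (hK : IsCompact K)
    (hKU : K ⊆ U)
    (huK : ∀ x, ∀ s ∈ Ioo a b, truncatedSum κ η C a d₁ d₂ (x, s) < Δ → x ∈ K)
    (ha : a < t₁) (h12 : t₁ ≤ t₂) (hb : t₂ < b) :
    energy Δ κ η C a d₁ d₂ t₂ ≤ energy Δ κ η C a d₁ d₂ t₁ := by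
  set f := testFunction Δ κ η C a t₁ t₂ d₁ d₂ with hf
  -- The steps are at most half of `t₁ - a`, which keeps every backward window inside `(a, b)`.
  let ε : ℕ → ℝ := fun n => (t₁ - a) / 2 / (n + 1)
  have hta : 0 < (t₁ - a) / 2 := by linarith
  have hε : ∀ n, 0 < ε n := fun n => by positivity
  have hεlim : Tendsto ε atTop (𝓝 0) := tendsto_const_nhds.div_atTop
    (tendsto_atTop_add_const_right _ _ tendsto_natCast_atTop_atTop)
  have hεa : ∀ n, a < t₁ - ε n := fun n => by
    have : ε n ≤ (t₁ - a) / 2 := div_le_self hta.le (by linarith [Nat.cast_nonneg (α := ℝ) n])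
    linarith
  have hm1 : t₁ ∈ Ioo a b := ⟨ha, by linarith⟩
  have hm2 : t₂ ∈ Ioo a b := ⟨by linarith, hb⟩
  have hfm : Measurable f := measurable_testFunction h₁.measurable h₂.measurable
  have hfB : ∀ p, |f p| ≤ Δ := fun p => by
    rw [abs_of_nonneg (testFunction_nonneg p)]
    exact testFunction_le hΔ h₁.nonneg h₂.nonneg p
  have hfL : ∀ t, LipschitzWith 2 fun x => f (x, t) := fun t =>
    lipschitz_testFunction hκ h₁.lipschitz h₂.lipschitz t
  have hfs : ∀ p, f p ≠ 0 → p ∈ K ×ˢ Ioc t₁ t₂ := fun p hp =>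
    mem_of_testFunction_ne_zero ha.le hb huK hp
  have hlim := h₁.tendsto_integral_diffPairing h₂ hK (f := f) (B := Δ)
    (φ := fun n p => forwardIntegral (ε n) f p / ε n)
    (fun n => (continuous_forwardIntegral (hε n).le hfm hfB
      fun t => (hfL t).continuous).div_const _)
    (fun n p => by
      rw [abs_div, abs_of_pos (hε n), div_le_iff₀ (hε n)]
      exact abs_forwardIntegral_le (hε n).le hfB p)
    (fun n p hp => (mem_of_forwardIntegral_ne_zero (hε n).le hfs
      (fun h0 => hp (by rw [h0, zero_div]))).1)
    (ae_tendsto_forwardIntegral_div hfm hfB hfL hε hεlim)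
  have hnonpos : ∫ p in univ ×ˢ Ioo a b, (diffPairing (fun x => f (x, p.2)) p.1 (z₁ p) +
      diffPairing (fun x => f (x, p.2)) p.1 (z₂ p)) ≤ 0 := by
    refine integral_nonpos_of_ae ?_
    filter_upwards [h₁.field, h₂.field] with p hp1 hp2
    exact testFunction_integral_add_nonpos hr hκ (h₁.lipschitz _).continuous
      (h₂.lipschitz _).continuous hp1 hp2
  have hii : ∀ {t}, t ∈ Ioo a b → (∀ n, a < t - ε n) → ∀ n,
      IntervalIntegrable (energy Δ κ η C a d₁ d₂) volume (t - ε n) t := fun {t} ht hta n =>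
    energy_intervalIntegrable h₁ h₂ hΔ hK huK ⟨hta n, by linarith [ht.2, hε n]⟩ ht
  have hl1 := tendsto_integral_div_of_tendsto_left
    (energy_tendsto_left h₁ h₂ hΔ hK huK hm1) hε hεlim (hii hm1 hεa)
  have hl2 := tendsto_integral_div_of_tendsto_left
    (energy_tendsto_left h₁ h₂ hΔ hK huK hm2) hε hεlim
    (hii hm2 fun n => (hεa n).trans_le (by linarith))
  -- After division by `ε`, the pairing tends to a nonnegative number and the right-hand side to the
  -- energy at `t₁` minus that at `t₂`.
  have hle := le_of_tendsto_of_tendsto (hlim.const_mul (-(1 / (2 * r)))) (hl1.sub hl2)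
    (Eventually.of_forall fun n => by
      have h := pairing_le_energy_sub hκ h₁ h₂ hΔ hK hKU huK (hε n) (hεa n) h12 hb
      simp only [diffPairing_div, integral_div]
      rw [← add_div, ← mul_div_assoc, ← sub_div]
      exact div_le_div_of_nonneg_right h (hε n).le)
  have hpos : 0 ≤ -(1 / (2 * r)) * ∫ p in univ ×ˢ Ioo a b,
      (diffPairing (fun x => f (x, p.2)) p.1 (z₁ p) +
        diffPairing (fun x => f (x, p.2)) p.1 (z₂ p)) :=
    mul_nonneg_of_nonpos_of_nonpos (by simp only [one_div, Left.neg_nonpos_iff]; positivity) hnonpos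
  linarith

end EnergyDecay

/-! ### Induction along the time axis. -/

/-- At the infimum of the failure times the property holds, by `hleft` or `h₀`; then `hright` keeps
failure times away from it. -/
theorem forall_ge_of_propagation {P : ℝ → Prop} {t₀ : ℝ} (h₀ : P t₀)
    (hleft : ∀ t, t₀ < t → (∀ s ∈ Ico t₀ t, P s) → P t)
    (hright : ∀ t, t₀ ≤ t → P t → ∃ τ, 0 < τ ∧ ∀ s ∈ Ioo t (t + τ), P s) :
    ∀ t, t₀ ≤ t → P t := by
  by_contra! hcon
  obtain ⟨t, ht, hPt⟩ := hcon
  set S := {t | t₀ ≤ t ∧ ¬P t} with hS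
  have hne : S.Nonempty := ⟨t, ht, hPt⟩
  have hbd : BddBelow S := ⟨t₀, fun s hs => hs.1⟩
  have hm : t₀ ≤ sInf S := le_csInf hne fun s hs => hs.1
  have hlt : ∀ s ∈ Ico t₀ (sInf S), P s := fun s hs => by
    by_contra hPs
    exact not_le.2 hs.2 (csInf_le hbd ⟨hs.1, hPs⟩)
  have hPm : P (sInf S) := by
    rcases eq_or_lt_of_le hm with h | h
    · rwa [← h]
    · exact hleft _ h hlt
  obtain ⟨τ, hτ, hP⟩ := hright _ hm hPm
  obtain ⟨s, hs, hsτ⟩ := exists_lt_of_csInf_lt hne (by linarith : sInf S < sInf S + τ)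
  rcases eq_or_lt_of_le (csInf_le hbd hs) with h | h
  · exact hs.2 (h ▸ hPm)
  · exact hs.2 (hP s ⟨h, hsτ⟩)

theorem exists_seq_tendsto_Ico {t₀ t : ℝ} (h : t₀ < t) :
    ∃ s : ℕ → ℝ, (∀ n, s n ∈ Ioo t₀ t) ∧ Tendsto s atTop (𝓝 t) := by
  obtain ⟨s, -, hs, hlim⟩ := exists_seq_strictMono_tendsto' h
  exact ⟨s, hs, hlim⟩

/-! ### Time slices of superflows and their distance functions. -/

section Slices

variable {r : ℝ} {E0 : Set (Space N)} {E : Set (Space N × ℝ)}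

theorem isClosed_slice (hE : IsClosed E) (t : ℝ) : IsClosed (slice E t) :=
  hE.preimage (by fun_prop : Continuous fun x : Space N => (x, t))

theorem measurableSet_of_isSigmaCompact {X : Type*} [TopologicalSpace X] [T2Space X]
    [MeasurableSpace X] [OpensMeasurableSpace X] {s : Set X} (hs : IsSigmaCompact s) :
    MeasurableSet s := by
  obtain ⟨K, hK, rfl⟩ := hs
  exact MeasurableSet.iUnion fun n => (hK n).isClosed.measurableSet

/-- A sublevel set is a projection of a closed set, and closed sets here are σ-compact, so their
continuous images are Borel. -/
theorem measurable_distTo (hE : IsClosed E) : Measurable (distTo E) := by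
  refine measurable_of_Iic fun c => ?_
  rcases lt_or_ge c 0 with hc | hc
  · convert MeasurableSet.empty
    ext p
    simp only [mem_preimage, mem_Iic, mem_empty_iff_false, iff_false, not_le]
    exact hc.trans_le Metric.infDist_nonneg
  -- Times with empty slice are treated apart: there `Metric.infDist` takes the default value 0, not
  -- `+∞`.
  · have h1 : MeasurableSet (Prod.snd ⁻¹' (Prod.snd '' E) : Set (Space N × ℝ)) :=
      measurable_snd (measurableSet_of_isSigmaCompact ((isSigmaCompact_univ.of_isClosed_subset
        hE (subset_univ _)).image continuous_snd))
    have h2 : MeasurableSet (Prod.fst '' {q : (Space N × ℝ) × Space N |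
        (q.2, q.1.2) ∈ E ∧ dist q.1.1 q.2 ≤ c}) := by
      refine measurableSet_of_isSigmaCompact (IsSigmaCompact.image continuous_fst ?_)
      refine isSigmaCompact_univ.of_isClosed_subset
        ((hE.preimage (f := fun q : (Space N × ℝ) × Space N => (q.2, q.1.2)) (by fun_prop)).inter
          (isClosed_le (f := fun q : (Space N × ℝ) × Space N => dist q.1.1 q.2)
            (g := fun _ => c) (by fun_prop) (by fun_prop))) (subset_univ _)
    convert h1.compl.union h2 using 1
    ext p
    simp only [mem_preimage, mem_Iic, mem_union, mem_compl_iff, mem_image, not_exists,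
      Prod.exists, exists_eq_right]
    constructor
    · intro hp
      by_cases hne : (slice E p.2).Nonempty
      · right
        obtain ⟨y, hy, hd⟩ := (isClosed_slice hE p.2).exists_infDist_eq_dist hne p.1
        exact ⟨p.1, p.2, y, ⟨hy, hd ▸ hp⟩, rfl⟩
      · left
        intro x hx
        exact hne ⟨x, hx⟩
    · rintro (hp | ⟨x, t, y, ⟨hy, hd⟩, rfl⟩)
      · have : slice E p.2 = ∅ := eq_empty_of_forall_notMem fun x hx => hp x hx
        simp [distTo, this, hc]
      · exact (Metric.infDist_le_dist_of_mem (s := slice E t) hy).trans hd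

/-- An extinct flow stays extinct: a point of a later slice would be a left limit of points of
earlier ones, and a thickening of the empty set is empty. Hence all slices before a nonempty one are
nonempty, and `Metric.infDist` is the true distance there. -/
theorem IsWeakSuperflow.slice_eq_empty_of_le (hE : IsWeakSuperflow r E0 E) {s t : ℝ} (ht : 0 ≤ t)
    (hst : t ≤ s) (h : slice E t = ∅) : slice E s = ∅ := by
  refine forall_ge_of_propagation (P := fun s => slice E s = ∅) h ?_ ?_ s hst
  · intro τ hτ hs
    by_contra hne
    obtain ⟨x, hx⟩ := nonempty_iff_ne_empty.2 hne
    obtain ⟨σ, hσ, hlim⟩ := exists_seq_tendsto_Ico hτ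
    obtain ⟨u, hu, -⟩ := (hE.left τ (ht.trans_lt hτ) σ
      (fun n => ⟨ht.trans (hσ n).1.le, (hσ n).2⟩) hlim).2 x hx
    have := hs (σ 0) ⟨(hσ 0).1.le, (hσ 0).2⟩
    exact (this ▸ hu 0 : u 0 ∈ (∅ : Set (Space N)))
  · intro τ hτ hs
    obtain ⟨ε, hε, h⟩ := hE.right τ (ht.trans hτ) 1 one_pos
    refine ⟨ε, hε, fun σ hσ => ?_⟩
    have := h σ hσ
    rwa [hs, Metric.thickening_empty, subset_empty_iff] at this

theorem IsWeakSuperflow.slice_nonempty_of_le (hE : IsWeakSuperflow r E0 E) {s t : ℝ} (hs : 0 ≤ s)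
    (hst : s ≤ t) (h : (slice E t).Nonempty) : (slice E s).Nonempty := by
  by_contra hcon
  exact h.ne_empty (hE.slice_eq_empty_of_le hs hst (not_nonempty_iff_eq_empty.1 hcon))

theorem le_extinctionTime {t : ℝ}
    (h : (slice E t).Nonempty) : (t : EReal) ≤ extinctionTime E := by
  refine le_iInf₂ fun s hs => ?_
  by_contra hcon
  have hlt : s < t := by exact_mod_cast not_le.1 hcon
  exact h.ne_empty (hs.2 t hlt.le)

/-- The two halves of Kuratowski convergence give the two bounds: cluster points of nearest points
for the lower one, approximating sequences for the upper one. -/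
theorem IsWeakSuperflow.tendsto_distTo_left (hE : IsWeakSuperflow r E0 E) {t : ℝ} (ht : 0 < t)
    (hne : (slice E t).Nonempty) (x : Space N) :
    Tendsto (fun s => distTo E (x, s)) (𝓝[<] t) (𝓝 (distTo E (x, t))) := by
  refine tendsto_of_seq_tendsto fun u hu => ?_
  have hev : ∀ᶠ n in atTop, u n ∈ Ico 0 t :=
    hu.eventually (by
      filter_upwards [Ioo_mem_nhdsLT ht] with s hs
      exact ⟨hs.1.le, hs.2⟩)
  obtain ⟨n₀, hn₀⟩ := eventually_atTop.1 hev
  rw [← tendsto_add_atTop_iff_nat n₀]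
  set s : ℕ → ℝ := fun n => u (n + n₀) with hsdef
  have hs : ∀ n, 0 ≤ s n ∧ s n < t := fun n => hn₀ _ (by omega)
  have hslim : Tendsto s atTop (𝓝 t) :=
    (tendsto_add_atTop_iff_nat n₀).2 (hu.mono_right nhdsWithin_le_nhds)
  obtain ⟨hK1, hK2⟩ := hE.left t ht s hs hslim
  have hcl : ∀ s, IsClosed (slice E s) := isClosed_slice hE.closed
  change Tendsto (fun n => distTo E (x, s n)) atTop _
  refine tendsto_order.2 ⟨fun c hc => ?_, fun c hc => ?_⟩
  · by_contra hcon
    rw [not_eventually] at hcon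
    have hnes : ∀ n, (slice E (s n)).Nonempty := fun n =>
      hE.slice_nonempty_of_le (hs n).1 (hs n).2.le hne
    choose w hw hwd using fun n => (hcl (s n)).exists_infDist_eq_dist (hnes n) x
    have hfreq : ∃ᶠ n in atTop, w n ∈ Metric.closedBall x c := hcon.mono fun n hn => by
      rw [Metric.mem_closedBall, dist_comm, ← hwd n]
      exact not_lt.1 hn
    obtain ⟨y, hy, hcluster⟩ := (isCompact_closedBall x c).exists_mapClusterPt_of_frequently hfreq
    have hyE := hK1 w hw y hcluster
    have := Metric.infDist_le_dist_of_mem (x := x) hyE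
    rw [Metric.mem_closedBall, dist_comm] at hy
    exact absurd (hc.trans_le (this.trans hy)) (lt_irrefl _)
  · obtain ⟨y, hy, hyd⟩ := (hcl t).exists_infDist_eq_dist hne x
    obtain ⟨v, hv, hvlim⟩ := hK2 y hy
    have hd : Tendsto (fun n => dist x (v n)) atTop (𝓝 (dist x y)) := tendsto_const_nhds.dist hvlim
    have hc' : dist x y < c := by
      rw [← hyd]
      exact hc
    filter_upwards [hd.eventually (gt_mem_nhds hc')] with n hn
    exact (Metric.infDist_le_dist_of_mem (hv n)).trans_lt hn

theorem infDist_sub_le_of_subset_thickening {A B : Set (Space N)} {δ : ℝ} (hA : A.Nonempty)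
    (h : A ⊆ Metric.thickening δ B) (x : Space N) :
    Metric.infDist x B - δ ≤ Metric.infDist x A := by
  refine (Metric.le_infDist hA).2 fun y hy => ?_
  obtain ⟨w, hw, hd⟩ := Metric.mem_thickening_iff.1 (h hy)
  have h1 := Metric.infDist_le_dist_of_mem (x := x) hw
  have h2 := dist_triangle x y w
  linarith

theorem measurableSet_spaceTimeCylinder (T : EReal) : MeasurableSet (spaceTimeCylinder N T) := by
  refine MeasurableSet.inter (measurableSet_lt measurable_const measurable_snd) ?_
  exact measurableSet_lt (measurable_coe_real_ereal.comp measurable_snd) measurable_const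

theorem IsNonlocalDivergence.pairing_restrict {T : EReal}
    {z : Space N × ℝ → Measure (Space N × Space N)} {μpos μneg : Measure (Space N × ℝ)}
    (h : IsNonlocalDivergence r T z μpos μneg) {U : Set (Space N)} {a b : ℝ}
    (hcyl : (univ : Set (Space N)) ×ˢ Ioo a b ⊆ spaceTimeCylinder N T) {φ : Space N × ℝ → ℝ}
    (hφ : Continuous φ) (hc : HasCompactSupport φ) (ht : tsupport φ ⊆ U ×ˢ Ioo a b) :
    (∫ p, φ p ∂μpos) - (∫ p, φ p ∂μneg) = -(1 / (2 * r)) * ∫ p in univ ×ˢ Ioo a b,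
        (∫ q, (φ (p.1 + q.1, p.2) - φ (p.1 + q.2, p.2)) ∂(z p)) := by
  rw [h.pairing φ hφ hc (ht.trans ((prod_mono (subset_univ U) Subset.rfl).trans hcyl))]
  congr 1
  refine setIntegral_eq_of_subset_of_forall_sdiff_eq_zero (measurableSet_spaceTimeCylinder T)
    hcyl fun p hp => ?_
  have hz : ∀ x : Space N, φ (x, p.2) = 0 := fun x => by
    by_contra hne
    exact hp.2 ⟨mem_univ _, (ht (subset_tsupport φ hne)).2⟩
  simp [hz]

theorem IsMeasureField.ae_attainsOsc {T : EReal} {z : Space N × ℝ → Measure (Space N × Space N)}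
    (hz : IsMeasureField r T z) {d : Space N × ℝ → ℝ} {a b : ℝ}
    (hcyl : (univ : Set (Space N)) ×ˢ Ioo a b ⊆ spaceTimeCylinder N T)
    (h : ∀ᵐ p ∂(volume.restrict (spaceTimeCylinder N T)), z p (Cr N r) ≤ 1 ∧
      ∫ q, (d (p.1 + q.1, p.2) - d (p.1 + q.2, p.2)) ∂(z p) =
        essOsc (Metric.ball p.1 r) (fun x => d (x, p.2))) :
    ∀ᵐ p ∂(volume.restrict (univ ×ˢ Ioo a b)), AttainsOsc r (fun x => d (x, p.2)) p.1 (z p) := by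
  have h1 := ae_mono (Measure.restrict_mono hcyl le_rfl) h
  filter_upwards [h1, ae_restrict_mem (MeasurableSet.univ.prod measurableSet_Ioo)] with p hp hpm
  have hconc := hz.concentrated p (hcyl hpm)
  refine ⟨?_, hconc, hp.2⟩
  rw [← union_compl_self (Cr N r)]
  refine (measure_union_le _ _).trans ?_
  rw [hconc, add_zero]
  exact hp.1

/-- The field and the density bound `M` depend only on `E` and `l`. They precede `C`, `U`, `a`, `b`,
so that two flows can share one constant, and a time interval can be chosen in terms of it. -/
theorem IsWeakSuperflow.exists_isLocalSupersolution (hE : IsWeakSuperflow r E0 E) {l : ℝ}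
    (hl : 0 < l) : ∃ (z : Space N × ℝ → Measure (Space N × Space N))
    (μpos μneg : Measure (Space N × ℝ)) (M : ℝ≥0), ∀ (C : ℝ≥0) (U : Set (Space N)) (a b : ℝ),
      M ≤ C → IsOpen U → 0 ≤ a → (slice E b).Nonempty →
      (∀ x ∈ U, ∀ s ∈ Ioo a b, l ≤ distTo E (x, s)) →
      IsLocalSupersolution r C U a b (distTo E) z μpos μneg := by
  obtain ⟨z, μpos, μneg, hz, hdiv, hloc, hweak, hosc, hac⟩ := hE.field
  obtain ⟨M, hM⟩ := hac l hl
  refine ⟨z, μpos, μneg, M, fun C U a b hMC hU ha hb hUl => ?_⟩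
  have hT : (b : EReal) ≤ extinctionTime E := le_extinctionTime hb
  have hcyl : (univ : Set (Space N)) ×ˢ Ioo a b ⊆ spaceTimeCylinder N (extinctionTime E) :=
    fun p hp => ⟨ha.trans_lt hp.2.1, (EReal.coe_lt_coe_iff.2 hp.2.2).trans_le hT⟩
  have hUcyl : U ×ˢ Ioo a b ⊆ spaceTimeCylinder N (extinctionTime E) :=
    (prod_mono (subset_univ U) Subset.rfl).trans hcyl
  have hUE : U ×ˢ Ioo a b ⊆ spaceTimeCylinder N (extinctionTime E) \ E := by
    intro p hp
    refine ⟨hUcyl hp, fun hpE => ?_⟩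
    have h1 := hUl p.1 hp.1 p.2 hp.2
    have h2 : distTo E p = 0 := Metric.infDist_zero_of_mem (show p.1 ∈ slice E p.2 from hpE)
    rw [Prod.mk.eta, h2] at h1
    linarith
  have hbound : μpos.restrict (U ×ˢ Ioo a b) ≤ C • volume := by
    have hsub : U ×ˢ Ioo a b ⊆
        {p | p ∈ spaceTimeCylinder N (extinctionTime E) ∧ l ≤ distTo E p} :=
      fun p hp => ⟨hUcyl hp, hUl p.1 hp.1 p.2 hp.2⟩
    refine (Measure.restrict_mono hsub le_rfl).trans (hM.trans ?_)
    refine Measure.le_iff.2 fun s _ => ?_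
    simp only [Measure.smul_apply]
    exact mul_le_mul' (ENNReal.coe_le_coe.2 hMC) le_rfl
  exact {
    isOpen := hU
    measurable := measurable_distTo hE.closed
    nonneg := fun p => Metric.infDist_nonneg
    lipschitz := fun s => Metric.lipschitz_infDist_pt (slice E s)
    left := fun s hs x => hE.tendsto_distTo_left (ha.trans_lt hs.1)
      (hE.slice_nonempty_of_le (ha.trans hs.1.le) hs.2.le hb) x
    integrable := fun K hK hKU => hloc.integrableOn_compact_subset (hKU.trans hUE) hK
    finite_pos := fun K hK hKU => hdiv.pos_radon K hK (hKU.trans hUcyl)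
    finite_neg := fun K hK hKU => hdiv.neg_radon K hK (hKU.trans hUcyl)
    weak := fun φ hφ hc ht h0 => hweak φ hφ hc (ht.trans hUE) h0
    pairing := fun φ hφ hc ht => hdiv.pairing_restrict hcyl hφ hc ht
    bound := hbound
    field_measurable := fun f hf =>
      (hz.measurable f hf).mono_measure (Measure.restrict_mono hcyl le_rfl)
    field := hz.ae_attainsOsc hcyl hosc }

end Slices

/-! ### Propagation of the separation and conclusion. -/

variable {r Δ : ℝ} {E0 G0 : Set (Space N)} {E G : Set (Space N × ℝ)}

/-- Two sets of points at mutual distance at least `Δ`. -/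
def Separated (Δ : ℝ) (A B : Set (Space N)) : Prop := ∀ x ∈ A, ∀ y ∈ B, Δ ≤ dist x y

theorem Separated.symm {A B : Set (Space N)} (h : Separated Δ A B) : Separated Δ B A :=
  fun x hx y hy => by
    rw [dist_comm]
    exact h y hy x hx

theorem Separated.le_infDist_add {A B : Set (Space N)} (h : Separated Δ A B) (hA : IsClosed A)
    (hB : IsClosed B) (hAn : A.Nonempty) (hBn : B.Nonempty) (x : Space N) :
    Δ ≤ Metric.infDist x A + Metric.infDist x B := by
  obtain ⟨y, hy, hyd⟩ := hA.exists_infDist_eq_dist hAn x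
  obtain ⟨w, hw, hwd⟩ := hB.exists_infDist_eq_dist hBn x
  rw [hyd, hwd, dist_comm x y]
  exact (h y hy w hw).trans (dist_triangle _ _ _)

theorem IsWeakSuperflow.separated_of_left (hE : IsWeakSuperflow r E0 E)
    (hG : IsWeakSuperflow r G0 G) {t₀ t : ℝ} (h₀ : 0 ≤ t₀) (ht : t₀ < t)
    (h : ∀ s ∈ Ioo t₀ t, Separated Δ (slice E s) (slice G s)) :
    Separated Δ (slice E t) (slice G t) := by
  intro x hx y hy
  obtain ⟨σ, hσ, hlim⟩ := exists_seq_tendsto_Ico ht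
  have hσ' : ∀ n, 0 ≤ σ n ∧ σ n < t := fun n => ⟨h₀.trans (hσ n).1.le, (hσ n).2⟩
  obtain ⟨u, hu, hulim⟩ := (hE.left t (h₀.trans_lt ht) σ hσ' hlim).2 x hx
  obtain ⟨v, hv, hvlim⟩ := (hG.left t (h₀.trans_lt ht) σ hσ' hlim).2 y hy
  exact ge_of_tendsto (hulim.dist hvlim)
    (Eventually.of_forall fun n => h _ (hσ n) _ (hu n) _ (hv n))

theorem IsWeakSuperflow.exists_distTo_ge (hE : IsWeakSuperflow r E0 E) {t₀ δ : ℝ} (ht₀ : 0 ≤ t₀)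
    (hδ : 0 < δ) : ∃ τ, 0 < τ ∧ ∀ s ∈ Ioo t₀ (t₀ + τ), (slice E s).Nonempty → ∀ x,
      distTo E (x, t₀) - δ ≤ distTo E (x, s) := by
  obtain ⟨τ, hτ, h⟩ := hE.right t₀ ht₀ δ hδ
  exact ⟨τ, hτ, fun s hs hne x => infDist_sub_le_of_subset_thickening hne (h s hs) x⟩

theorem isBounded_or_isBounded (hE : IsWeakSuperflow r E0 E) (hG : IsWeakSuperflow r G0 G) {t : ℝ}
    (ht : 0 ≤ t) (hΔ : 0 < Δ) (h : Separated Δ (slice E t) (slice G t)) :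
    Bornology.IsBounded (slice E t) ∨ Bornology.IsBounded (slice G t) := by
  rcases hE.bounded with hb | hb
  · exact Or.inl (hb t ht)
  rcases hG.bounded with hb' | hb'
  · exact Or.inr (hb' t ht)
  -- If both complements are bounded, disjointness makes them cover the whole space, so every set is
  -- bounded.
  refine Or.inl (((hb t ht).union (hb' t ht)).subset fun x _ => ?_)
  rw [← compl_inter]
  intro hx
  have := h x hx.1 x hx.2
  rw [dist_self] at this
  linarith

theorem isCompact_strip (hE : IsClosed E) {t c : ℝ} (hne : (slice E t).Nonempty)
    (hb : Bornology.IsBounded (slice E t)) :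
    IsCompact {x : Space N | c ≤ distTo E (x, t) ∧ c ≤ distTo G (x, t) ∧
      distTo E (x, t) ≤ Δ} := by
  have h1 : Continuous fun x => distTo E (x, t) := Metric.continuous_infDist_pt (slice E t)
  have h2 : Continuous fun x => distTo G (x, t) := Metric.continuous_infDist_pt (slice G t)
  refine Metric.isCompact_of_isClosed_isBounded ?_ ?_
  · exact (isClosed_le continuous_const h1).inter
      ((isClosed_le continuous_const h2).inter (isClosed_le h1 continuous_const))
  · refine (hb.cthickening (δ := Δ)).subset fun x hx => ?_
    obtain ⟨y, hy, hd⟩ := (isClosed_slice hE t).exists_infDist_eq_dist hne x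
    refine Metric.mem_cthickening_of_dist_le x y Δ _ hy ?_
    rw [← hd]
    exact hx.2.2

/-- Boundedness of one slice makes the region between the two sets compact; on it the energy is
defined, nonincreasing, and initially zero in the limit. -/
theorem IsWeakSuperflow.separated_right_of_isBounded (hr : 0 < r) (hE : IsWeakSuperflow r E0 E)
    (hG : IsWeakSuperflow r G0 G) {t₀ : ℝ} (ht₀ : 0 ≤ t₀) (hΔ : 0 < Δ)
    (h : Separated Δ (slice E t₀) (slice G t₀)) (hb : Bornology.IsBounded (slice E t₀)) :
    ∃ τ, 0 < τ ∧ ∀ t ∈ Ioo t₀ (t₀ + τ), Separated Δ (slice E t) (slice G t) := by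
  set δ := Δ / 32 with hδ
  have hδ0 : 0 < δ := by positivity
  obtain ⟨z₁, μpos₁, μneg₁, M₁, hsol₁⟩ := hE.exists_isLocalSupersolution hδ0
  obtain ⟨z₂, μpos₂, μneg₂, M₂, hsol₂⟩ := hG.exists_isLocalSupersolution hδ0
  obtain ⟨τ₁, hτ₁, hd₁⟩ := hE.exists_distTo_ge ht₀ hδ0
  obtain ⟨τ₂, hτ₂, hd₂⟩ := hG.exists_distTo_ge ht₀ hδ0
  set C : ℝ≥0 := max M₁ M₂ with hC
  -- The last term limits the rise of the truncation level: from `4 * δ` it stays below `8 * δ = Δ /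
  -- 4`.
  refine ⟨min (min τ₁ τ₂) (4 * δ / (C + 1)), by positivity, fun t ht => ?_⟩
  have htτ₁ : t < t₀ + τ₁ := ht.2.trans_le
    (by linarith [min_le_left (min τ₁ τ₂) (4 * δ / (C + 1)), min_le_left τ₁ τ₂])
  have htτ₂ : t < t₀ + τ₂ := ht.2.trans_le
    (by linarith [min_le_left (min τ₁ τ₂) (4 * δ / (C + 1)), min_le_right τ₁ τ₂])
  have hCt : C * (t - t₀) ≤ 4 * δ := by
    have h1 : t - t₀ ≤ 4 * δ / (C + 1) := by
      linarith [ht.2, min_le_right (min τ₁ τ₂) (4 * δ / (C + 1))]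
    rw [le_div_iff₀ (by positivity)] at h1
    nlinarith [ht.1, C.coe_nonneg]
  intro x₀ hx₀ y₀ hy₀
  have hneE : ∀ s, 0 ≤ s → s ≤ t → (slice E s).Nonempty := fun s hs hst =>
    hE.slice_nonempty_of_le hs hst ⟨x₀, hx₀⟩
  have hneG : ∀ s, 0 ≤ s → s ≤ t → (slice G s).Nonempty := fun s hs hst =>
    hG.slice_nonempty_of_le hs hst ⟨y₀, hy₀⟩
  have hdE : ∀ s ∈ Ioo t₀ t, ∀ x, distTo E (x, t₀) - δ ≤ distTo E (x, s) := fun s hs x =>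
    hd₁ s ⟨hs.1, hs.2.trans htτ₁⟩ (hneE s (ht₀.trans hs.1.le) hs.2.le) x
  have hdG : ∀ s ∈ Ioo t₀ t, ∀ x, distTo G (x, t₀) - δ ≤ distTo G (x, s) := fun s hs x =>
    hd₂ s ⟨hs.1, hs.2.trans htτ₂⟩ (hneG s (ht₀.trans hs.1.le) hs.2.le) x
  have hsum₀ : ∀ x, Δ ≤ distTo E (x, t₀) + distTo G (x, t₀) := fun x =>
    h.le_infDist_add (isClosed_slice hE.closed _) (isClosed_slice hG.closed _)
      (hneE t₀ ht₀ ht.1.le) (hneG t₀ ht₀ ht.1.le) x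
  have hcE : ∀ s, Continuous fun x => distTo E (x, s) := fun s =>
    Metric.continuous_infDist_pt (slice E s)
  have hcG : ∀ s, Continuous fun x => distTo G (x, s) := fun s =>
    Metric.continuous_infDist_pt (slice G s)
  -- One `δ` is lost between `t₀` and later times, so both distances are at least `δ` on `U`, the
  -- threshold used for the density bound.
  set U : Set (Space N) := {x | 2 * δ < distTo E (x, t₀) ∧ 2 * δ < distTo G (x, t₀)} with hUdef
  set K : Set (Space N) := {x | 3 * δ ≤ distTo E (x, t₀) ∧ 3 * δ ≤ distTo G (x, t₀) ∧
    distTo E (x, t₀) ≤ Δ + δ} with hKdef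
  have hU : IsOpen U := (isOpen_lt continuous_const (hcE t₀)).inter
    (isOpen_lt continuous_const (hcG t₀))
  have hK : IsCompact K := isCompact_strip hE.closed (hneE t₀ ht₀ ht.1.le) hb
  have hKU : K ⊆ U := fun x hx => ⟨by linarith [hx.1], by linarith [hx.2.1]⟩
  have hS₁ := hsol₁ C U t₀ t (le_max_left _ _) hU ht₀ ⟨x₀, hx₀⟩
    fun x hx s hs => by linarith [hdE s hs x, hx.1]
  have hS₂ := hsol₂ C U t₀ t (le_max_right _ _) hU ht₀ ⟨y₀, hy₀⟩
    fun x hx s hs => by linarith [hdG s hs x, hx.2]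
  -- The energy is controlled only on the open interval; time `t` is reached as a left limit.
  refine hE.separated_of_left hG ht₀ ht.1 (fun s hs => ?_) x₀ hx₀ y₀ hy₀
  intro x hx y hy
  by_contra! hlt
  set κ := min ((Δ - dist x y) / 4) δ with hκdef
  have hκ : 0 < κ := lt_min (by linarith) hδ0
  -- Both truncated distances are at least `4 * δ`, so a sum below `Δ` leaves each distance below `Δ
  -- - 4 * δ`. At time `t₀` each is then below `Δ - 3 * δ`, hence the other exceeds `3 * δ`.
  have huK : ∀ w, ∀ σ ∈ Ioo t₀ t,
      truncatedSum κ (4 * δ) C t₀ (distTo E) (distTo G) (w, σ) < Δ → w ∈ K := by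
    intro w σ hσ hw
    have e1 := le_truncated κ (4 * δ) C t₀ (distTo E) (w, σ)
    have e2 := le_truncated κ (4 * δ) C t₀ (distTo G) (w, σ)
    have e3 := level_le_truncated κ (4 * δ) C t₀ (distTo E) (w, σ)
    have e4 := level_le_truncated κ (4 * δ) C t₀ (distTo G) (w, σ)
    have e5 := hdE σ hσ w
    have e6 := hdG σ hσ w
    have e7 := hsum₀ w
    have e8 : 0 ≤ C * (σ - t₀) := mul_nonneg C.coe_nonneg (by linarith [hσ.1])
    unfold truncatedSum at hw
    simp only at e3 e4
    refine ⟨by linarith, by linarith, by linarith⟩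
  -- Close enough to `t₀` each distance has dropped by at most `m`, so the sum is at least `Δ - 2 *
  -- m`; the decay of the energy carries the bound to `s`.
  have hsmall : ∀ m : ℝ, 0 < m → energy Δ κ (4 * δ) C t₀ (distTo E) (distTo G) s ≤
      volume.real K * ((2 * m) ^ 2 / 2) := by
    intro m hm
    obtain ⟨σ₁, hσ₁, hm₁⟩ := hE.exists_distTo_ge ht₀ hm
    obtain ⟨σ₂, hσ₂, hm₂⟩ := hG.exists_distTo_ge ht₀ hm
    obtain ⟨t₁, ht₁, ht₁'⟩ := exists_between
      (show t₀ < min s (t₀ + min σ₁ σ₂) from lt_min hs.1 (by linarith [lt_min hσ₁ hσ₂]))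
    have hts : t₁ < s := ht₁'.trans_le (min_le_left _ _)
    have hts₁ : t₁ < t₀ + σ₁ := (ht₁'.trans_le (min_le_right _ _)).trans_le
      (by linarith [min_le_left σ₁ σ₂])
    have hts₂ : t₁ < t₀ + σ₂ := (ht₁'.trans_le (min_le_right _ _)).trans_le
      (by linarith [min_le_right σ₁ σ₂])
    refine (energy_antitone hr hκ hS₁ hS₂ hΔ.le hK hKU huK ht₁ hts.le hs.2).trans ?_
    refine energy_le_mul hK (fun w => penalty_le (by linarith) ?_)
      fun w => huK w t₁ ⟨ht₁, hts.trans hs.2⟩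
    have e1 := le_truncated κ (4 * δ) C t₀ (distTo E) (w, t₁)
    have e2 := le_truncated κ (4 * δ) C t₀ (distTo G) (w, t₁)
    have e5 := hm₁ t₁ ⟨ht₁, hts₁⟩ (hneE t₁ (by linarith) (by linarith [hs.2])) w
    have e6 := hm₂ t₁ ⟨ht₁, hts₂⟩ (hneG t₁ (by linarith) (by linarith [hs.2])) w
    have e7 := hsum₀ w
    unfold truncatedSum
    linarith
  have hzero : energy Δ κ (4 * δ) C t₀ (distTo E) (distTo G) s ≤ 0 := by
    have hlim : Tendsto (fun m : ℝ => volume.real K * ((2 * m) ^ 2 / 2)) (𝓝[>] 0)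
        (𝓝 (volume.real K * ((2 * 0) ^ 2 / 2))) :=
      ((by fun_prop : Continuous fun m : ℝ => volume.real K * ((2 * m) ^ 2 / 2)).tendsto
        0).mono_left nhdsWithin_le_nhds
    have := ge_of_tendsto hlim (by
      filter_upwards [self_mem_nhdsWithin] with m hm
      exact hsmall m hm)
    simpa using this
  have hcont : Continuous fun w =>
      penalty Δ (truncatedSum κ (4 * δ) C t₀ (distTo E) (distTo G) (w, s)) :=
    (continuous_penalty Δ).comp ((continuous_truncated κ (4 * δ) C t₀ s (hcE s)).add
      (continuous_truncated κ (4 * δ) C t₀ s (hcG s)))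
  have hint : Integrable fun w =>
      penalty Δ (truncatedSum κ (4 * δ) C t₀ (distTo E) (distTo G) (w, s)) :=
    hcont.integrable_of_hasCompactSupport (HasCompactSupport.intro hK fun w hw => by
      by_contra hne
      exact hw (huK w s hs (lt_of_penalty_ne_zero hne)))
  have hae := (integral_eq_zero_iff_of_nonneg (fun w => penalty_nonneg _ _) hint).1
    (le_antisymm hzero (energy_nonneg _ _ _ _ _ _ _ _))
  have hall := (hcont.ae_eq_iff_eq volume continuous_const).1 hae
  -- At the midpoint both distances are at most half of `dist x y < Δ`. As the level is at most `Δ /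
  -- 4` and `κ` is small, the truncated sum stays below `Δ` and the penalty is positive.
  have hm := congrFun hall (midpoint ℝ x y)
  have d1 : distTo E (midpoint ℝ x y, s) ≤ dist x y / 2 := by
    refine (Metric.infDist_le_dist_of_mem (s := slice E s) hx).trans_eq ?_
    rw [dist_midpoint_left]
    norm_num
    ring
  have d2 : distTo G (midpoint ℝ x y, s) ≤ dist x y / 2 := by
    refine (Metric.infDist_le_dist_of_mem (s := slice G s) hy).trans_eq ?_
    rw [dist_midpoint_right]
    norm_num
    ring
  have hκ1 : κ ≤ (Δ - dist x y) / 4 := min_le_left _ _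
  have hκ2 : κ ≤ δ := min_le_right _ _
  have hlev : 4 * δ + C * (s - t₀) ≤ 8 * δ := by
    have : C * (s - t₀) ≤ C * (t - t₀) :=
      mul_le_mul_of_nonneg_left (by linarith [hs.2]) C.coe_nonneg
    linarith
  have hT : ∀ D : Set (Space N × ℝ), distTo D (midpoint ℝ x y, s) ≤ dist x y / 2 →
      truncated κ (4 * δ) C t₀ (distTo D) (midpoint ℝ x y, s) < Δ / 2 := by
    intro D hD
    refine (truncated_le hκ (4 * δ) C t₀ (distTo D) _).trans_lt ?_
    have : max (distTo D (midpoint ℝ x y, s)) (4 * δ + C * (s - t₀)) < Δ / 2 - κ :=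
      max_lt (by linarith) (by linarith)
    simp only
    linarith
  have hu : truncatedSum κ (4 * δ) C t₀ (distTo E) (distTo G) (midpoint ℝ x y, s) < Δ := by
    have := hT E d1
    have := hT G d2
    unfold truncatedSum
    linarith
  have hpos : 0 < penalty Δ
      (truncatedSum κ (4 * δ) C t₀ (distTo E) (distTo G) (midpoint ℝ x y, s)) := by
    unfold penalty
    have : 0 < max (Δ - truncatedSum κ (4 * δ) C t₀ (distTo E) (distTo G) (midpoint ℝ x y, s)) 0 :=
      lt_max_of_lt_left (by linarith)
    positivity
  exact hpos.ne' hm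

theorem IsWeakSuperflow.separated (hr : 0 < r) (hE : IsWeakSuperflow r E0 E)
    (hG : IsWeakSuperflow r G0 G) (hΔ : 0 < Δ) (h : Separated Δ (slice E 0) (slice G 0)) {t : ℝ}
    (ht : 0 ≤ t) : Separated Δ (slice E t) (slice G t) := by
  refine forall_ge_of_propagation (P := fun t => Separated Δ (slice E t) (slice G t)) h
    (fun t ht hs => hE.separated_of_left hG le_rfl ht fun s hs' => hs s (Ioo_subset_Ico_self hs'))
    (fun t ht hs => ?_) t ht
  rcases isBounded_or_isBounded hE hG ht hΔ hs with hb | hb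
  · exact hE.separated_right_of_isBounded hr hG ht hΔ hs hb
  · obtain ⟨τ, hτ, hsep⟩ := hG.separated_right_of_isBounded hr hE ht hΔ hs.symm hb
    exact ⟨τ, hτ, fun s hs => (hsep s hs).symm⟩

theorem le_setDist_iff {c : ℝ≥0} {A B : Set (Space N)} :
    (c : ENNReal) ≤ setDist A B ↔ Separated c A B := by
  simp only [setDist, le_iInf_iff, Separated, edist_nndist, ENNReal.coe_le_coe, ← NNReal.coe_le_coe,
    coe_nndist]

end MinkowskiFlow

theorem theorem3p11 (N : ℕ) (r : ℝ) (hr : 0 < r)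
    (E0 F0 : Set (MinkowskiFlow.Space N))
    (hE0 : IsClosed E0) (hE0b : IsCompact (frontier E0))
    (hF0 : IsClosed F0) (hF0b : IsCompact (frontier F0))
    (E F : Set (MinkowskiFlow.Space N × ℝ))
    (hE : MinkowskiFlow.IsWeakSuperflow r E0 E)
    (hF : MinkowskiFlow.IsWeakSubflow r F0 F)
    (hΔ : 0 < MinkowskiFlow.setDist E0 F0ᶜ) :
    ∀ t : ℝ, 0 ≤ t →
      MinkowskiFlow.setDist E0 F0ᶜ ≤
        MinkowskiFlow.setDist (MinkowskiFlow.slice E t) (MinkowskiFlow.slice F t)ᶜ := by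
  intro t ht
  -- The initial distance may be infinite, so the comparison is run for every finite `c` below it.
  refine ENNReal.le_of_forall_nnreal_lt fun c hc => ?_
  rcases eq_or_ne c 0 with rfl | hc0
  · simp
  have hsep := MinkowskiFlow.le_setDist_iff.1 hc.le
  have hinit : MinkowskiFlow.Separated c (MinkowskiFlow.slice E 0)
      (MinkowskiFlow.slice (MinkowskiFlow.halfSpace N \ F) 0) := by
    intro x hx y hy
    -- The complementary superflow starts in the complement of the interior, which is the closure of
    -- `F0ᶜ`; separation survives the closure.
    have hy' : y ∈ closure F0ᶜ := by
      rw [closure_compl]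
      exact hF.compl.initial hy
    exact closure_minimal (fun w hw => hsep x (hE.initial hx) w hw)
      (isClosed_le continuous_const (by fun_prop : Continuous fun w => dist x w)) hy'
  have hfin := hE.separated hr hF.compl (by positivity) hinit ht
  refine MinkowskiFlow.le_setDist_iff.2 fun x hx y hy => hfin x hx y ⟨ht, hy⟩
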